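/- Consider the three-receiver AWGN broadcast channel: for a codeword $X^{(n)}\in\mathbb{R}^n$ receiver $i\in\{1,2,3\}$ observes $Y_i^{(n)}=X^{(n)}+Z_i^{(n)}$, where $Z_i^{(n)}$ has i.i.d. $\mathcal{N}(0,N_i)$ components and $0<N_1\le N_2\le N_3$. The independent messages $M_1,M_2,M_3$ are uniform, $M_i$ takes $\lceil 2^{nR_i}\rceil$ values and is requested by receiver $i$; the codeword is a function of $(M_1,M_2,M_3)$ with $\sum_{l=1}^n E(X_l^2)\le nP$, where $P\ge 0$. The side information is given by a directed graph $\mathcal{G}$ on $\{1,2,3\}$: receiver $i$ knows $M_j$ a priori if and only if $j\in\mathcal{O}_i:=\{j : (i\to j)\in\mathcal{G}\}$. A triple $(R_1,R_2,R_3)$ of non-negative reals is achievable if there is a sequence of codes, one for each block length $n$, for which the probability that receiver $i$ decodes $M_i$ wrongly tends to $0$ as $n\to\infty$ for every $i$. Let $C(q)=\frac12\log_2(1+q)$. Let $\mathcal{G}$ be a member of group 7, that is, the union of $\mathcal{G}_{17}=\{3\to1,\,3\to2\}$ with any one of the eight subsets of $\{1\to2,\,1\to3,\,2\to3\}$. Let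 $\mathscr{R}'_{\text{in}}$ be the set of all triples $(R_1,R_2,R_3)$ of non-negative reals such that, for some $\alpha\in[0,1]$, the following holds. (i) If $(2\to3)\notin\mathcal{G}$ (the members $\mathcal{G}_{17}\cup\mathcal{G}_{2k}$, $k=1,3,4,6$): $$R_2+\sum_{i\in\{1,3\}\setminus\mathcal{O}_1}R_i<C\!\left(\tfrac{(1-\alpha)P}{\alpha P+N_2}\right)+C\!\left(\tfrac{\alpha P}{N_1}\right),\qquad R_2<C\!\left(\tfrac{(1-\alpha)P}{\alpha P+N_2}\right),$$ $$R_2+R_3<C\!\left(\tfrac{(1-\alpha)P}{\alpha P+N_2}\right)+C\!\left(\tfrac{\alpha P}{N_3}\right),\qquad R_3<C\!\left(\tfrac{P}{N_3}\right).$$ (ii) If $(2\to3)\in\mathcal{G}$ (the members $\mathcal{G}_{17}\cup\mathcal{G}_{2k}$, $k=2,5,7,8$): $$R_1<C\!\left(\tfrac{\alpha P}{N_1}\right),\qquad \sum_{i\in\{1,3\}\setminus\mathcal{O}_1}R_i<C\!\left(\tfrac{P}{N_1}\right),\qquad R_2<C\!\left(\tfrac{(1-\alpha)P}{\alpha P+N_2}\right),\qquad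 R_3<C\!\left(\tfrac{P}{N_3}\right).$$ Then every $(R_1,R_2,R_3)\in\mathscr{R}'_{\text{in}}$ is achievable. -/

import Mathlib

open MeasureTheory ProbabilityTheory Filter Topology

noncomputable section

namespace AWGNBroadcast

/-- A side information graph on the receivers: the set of its arcs. The receivers `1, 2, 3` of the
three-receiver channel are the elements `0, 1, 2` of `Fin 3`. The pair `(i, j)` is the arc `i → j`:
receiver `i` knows the message requested by receiver `j`. -/
abbrev SideInfoGraph := Finset (Fin 3 × Fin 3)

/-- The out-neighbours of `i`: the indices of the messages that receiver `i` knows a priori. -/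
def outNeighbors (G : SideInfoGraph) (i : Fin 3) : Finset (Fin 3) :=
  Finset.univ.filter fun j => (i, j) ∈ G

/-- The leader of group 7, with arcs `3 → 1` and `3 → 2` (receivers numbered `1, 2, 3`). -/
def groupLeader7 : SideInfoGraph := {(2, 0), (2, 1)}

/-- The arcs from a receiver to a weaker one: `1 → 2`, `1 → 3`, `2 → 3`. The eight subsets of this
set are the eight graphs that are joined to a group leader to form its group. -/
def arcsToWeaker : SideInfoGraph := {(0, 1), (0, 2), (1, 2)}

/-- The members of group 7. -/
def IsGroup7Member (G : SideInfoGraph) : Prop :=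
  ∃ T : SideInfoGraph, T ⊆ arcsToWeaker ∧ G = groupLeader7 ∪ T

/-- The number of messages at rate `R` bits per channel use with block length `n`. -/
def numMessages (n : ℕ) (R : ℝ) : ℕ := ⌈(2 : ℝ) ^ ((n : ℝ) * R)⌉₊

/-- The message triples `(m₁, m₂, m₃)`. -/
abbrev Messages (n : ℕ) (R : Fin 3 → ℝ) := (i : Fin 3) → Fin (numMessages n (R i))

/-- The part of a message triple that receiver `i` knows a priori. -/
abbrev SideInfo (G : SideInfoGraph) (n : ℕ) (R : Fin 3 → ℝ) (i : Fin 3) :=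
  (j : {j : Fin 3 // j ∈ outNeighbors G i}) → Fin (numMessages n (R j))

/-- A block code of length `n` and rates `R` under the average power constraint
`∑ₗ E(Xₗ²) ≤ n P`, the expectation being over independent, uniformly distributed messages.
Receiver `i` estimates its message from its channel output and from the messages it knows. -/
structure Code (G : SideInfoGraph) (P : ℝ) (R : Fin 3 → ℝ) (n : ℕ) where
  enc : Messages n R → (Fin n → ℝ)
  dec : (i : Fin 3) → (Fin n → ℝ) → SideInfo G n R i → Fin (numMessages n (R i))
  measurable_dec : ∀ i s, Measurable fun y => dec i y s
  power : (∑ l, (∑ m, enc m l ^ 2) / (Fintype.card (Messages n R) : ℝ)) ≤ n * P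

/-- The law of `n` i.i.d. noise samples with distribution `𝓝(0, v)`. -/
def noiseLaw (n : ℕ) (v : ℝ) : Measure (Fin n → ℝ) :=
  Measure.pi fun _ => gaussianReal 0 v.toNNReal

/-- The probability that receiver `i` decodes its message wrongly, when the messages are independent
and uniform and the noise variances are `N 0, N 1, N 2`. -/
def Code.errorProb {G : SideInfoGraph} {P : ℝ} {R : Fin 3 → ℝ} {n : ℕ} (c : Code G P R n)
    (N : Fin 3 → ℝ) (i : Fin 3) : ℝ :=
  (∑ m : Messages n R,
    (noiseLaw n (N i)).real {z | c.dec i (c.enc m + z) (fun j => m j) ≠ m i}) /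
      (Fintype.card (Messages n R) : ℝ)

/-- The rate triple `R` is achievable: there are codes of all block lengths for which the error
probability of every receiver tends to zero. By the union bound this is the same as asking that the
probability that some receiver errs tends to zero, whatever the joint law of the three noises. -/
def Achievable (G : SideInfoGraph) (P : ℝ) (N : Fin 3 → ℝ) (R : Fin 3 → ℝ) : Prop :=
  ∃ c : (n : ℕ) → Code G P R n, ∀ i, Tendsto (fun n => (c n).errorProb N i) atTop (𝓝 0)

/-- `C(q) = (1/2) log₂ (1 + q)`. -/
def gaussC (q : ℝ) : ℝ := 1 / 2 * Real.logb 2 (1 + q)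

/-- The sum of the rates `R_i` over `i ∈ {1, 3} ∖ O₁`. -/
def sumRate13 (G : SideInfoGraph) (R : Fin 3 → ℝ) : ℝ :=
  ∑ i ∈ ({0, 2} : Finset (Fin 3)) \ outNeighbors G 0, R i

/-- The bounds for the members in which receiver 2 does not know the third message. -/
def SplitBounds (G : SideInfoGraph) (P : ℝ) (N : Fin 3 → ℝ) (R : Fin 3 → ℝ) (α : ℝ) : Prop :=
  R 1 + sumRate13 G R < gaussC ((1 - α) * P / (α * P + N 1)) + gaussC (α * P / N 0) ∧
  R 1 < gaussC ((1 - α) * P / (α * P + N 1)) ∧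
  R 1 + R 2 < gaussC ((1 - α) * P / (α * P + N 1)) + gaussC (α * P / N 2) ∧
  R 2 < gaussC (P / N 2)

/-- The bounds for the members in which receiver 2 knows the third message. -/
def XorBounds (G : SideInfoGraph) (P : ℝ) (N : Fin 3 → ℝ) (R : Fin 3 → ℝ) (α : ℝ) : Prop :=
  R 0 < gaussC (α * P / N 0) ∧
  sumRate13 G R < gaussC (P / N 0) ∧
  R 1 < gaussC ((1 - α) * P / (α * P + N 1)) ∧
  R 2 < gaussC (P / N 2)

/-- The inner bound region of the member `G` of group 7. -/
def innerRegion7 (G : SideInfoGraph) (P : ℝ) (N : Fin 3 → ℝ) : Set (Fin 3 → ℝ) :=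
  {R | (∀ i, 0 ≤ R i) ∧ ∃ α : ℝ, 0 ≤ α ∧ α ≤ 1 ∧
    (((1, 2) ∉ G ∧ SplitBounds G P N R α) ∨ ((1, 2) ∈ G ∧ XorBounds G P N R α))}

end AWGNBroadcast

end

/-!
# Achievability of the inner bound for group 7

The proof is random coding with a two-layer Gaussian superposition codebook. Each codeword is the
sum of a cloud centre of power `(1 - α) p` and of a satellite of power `α p`, with `p` slightly less
than `P`. Receiver `1` decodes the cloud centre and takes the satellite for noise; receivers `0` and
`2` decode both layers. (Receivers and messages are numbered from `0` to `2`.)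

*Decoding.* A receiver compares with a threshold, for every candidate that agrees with its side
information, the quadratic form `score`, which is minus the information density up to a constant.
Whatever the output is, an independent Gaussian word of power `p` passes the test against noise of
variance `ν` with probability at most `exp (n τ) (1 + p / ν) ^ (-n / 2)`
(`noiseLaw_score_le`, an exact Gaussian integral and Markov's inequality), which is
`2 ^ (-n C (p / ν))` up to the factor `exp (n τ)`. The true word fails only if a Gaussian energy
deviates from its mean (`measure_score_gt_le`, by Chernoff bounds). Against a candidate with the
right cloud centre only the satellite layer helps, against any other candidate both layers do. Hence
it is enough that the numbers of rival candidates grow at rates below the capacities of these layers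
(`achievable_of_superposition`). The power constraint is one on the average over the messages; it
is included in the selection of the codebook, and by convexity of `exp` it needs no independence
between codewords (`measure_power_gt_le`).

*The indices.* If receiver `1` does not know message `2`, the cloud centre carries message `1` and a
residue, at a rate `ρ`, of a number `pairIndex` made of messages `0` and `2`: their sum if receiver
`0` knows message `2`, and a position number of the pair otherwise. Taking residues plays the part
of rate splitting, and taking the sum that of network coding: receivers `0` and `2` each know one
summand. Fixing the cloud divides the number of rivals by `2 ^ (n ρ)`, and the bounds of the
region are what is needed for a suitable `ρ` to exist (`achievable_of_split_bounds`). If receiver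
`1` knows message `2`, the cloud centre carries the sum of messages `1` and `2` modulo the larger
message number, and the satellite carries message `0` as well (`achievable_of_xor_bounds`). In both
cases the assumption that receiver `0` is stronger than receiver `1` gives the missing bound on the
sum rate of receiver `0` (`gaussC_layers_le`).
-/

open scoped ENNReal NNReal

namespace AWGNBroadcast

/-! ### Gaussian vectors -/

/-- The energy `∑ₗ xₗ²` of a real vector, i.e. its squared Euclidean norm. -/
def energy {n : ℕ} (x : Fin n → ℝ) : ℝ := ∑ l, x l ^ 2

@[fun_prop]
lemma measurable_energy {n : ℕ} : Measurable (energy (n := n)) := by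
  unfold energy; fun_prop

instance {n : ℕ} {v : ℝ} : IsProbabilityMeasure (noiseLaw n v) := by
  unfold noiseLaw; infer_instance

/-- The Gaussian density of variance `v`, tilted by `exp (-t (y - x)²)`, is again a Gaussian
density, up to a factor that does not depend on `x`. -/
lemma lintegral_exp_sq_sub_gaussianReal (v : ℝ≥0) (t y : ℝ) (ht : 0 < 1 + 2 * t * v) :
    ∫⁻ x, ENNReal.ofReal (Real.exp (-t * (y - x) ^ 2)) ∂(gaussianReal 0 v) =
      ENNReal.ofReal ((1 + 2 * t * v) ^ (-(1 / 2) : ℝ) *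
        Real.exp (-t * y ^ 2 / (1 + 2 * t * v))) := by
  rcases eq_or_ne v 0 with rfl | hv
  · simp
  have hv' : (0 : ℝ) < v := NNReal.coe_pos.2 (pos_iff_ne_zero.2 hv)
  set D : ℝ := 1 + 2 * t * v with hD
  -- the tilted density is the one with variance `v / D` and mean `2 t v y / D`
  have hw : v / D.toNNReal ≠ 0 := div_ne_zero hv (by simpa using ht)
  have hwc : ((v / D.toNNReal : ℝ≥0) : ℝ) = v / D := by
    simp [Real.coe_toNNReal _ ht.le]
  rw [gaussianReal_of_var_ne_zero _ hv,
    lintegral_withDensity_eq_lintegral_mul _ (measurable_gaussianPDF _ _) (by fun_prop)]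
  have key : ∀ x, (gaussianPDF 0 v * fun x => ENNReal.ofReal (Real.exp (-t * (y - x) ^ 2))) x =
      ENNReal.ofReal (D ^ (-(1 / 2) : ℝ) * Real.exp (-t * y ^ 2 / D)) *
        gaussianPDF (2 * t * v * y / D) (v / D.toNNReal) x := by
    intro x
    simp only [Pi.mul_apply, gaussianPDF]
    rw [← ENNReal.ofReal_mul (gaussianPDFReal_nonneg _ _ _), ← ENNReal.ofReal_mul (by positivity)]
    congr 1
    simp only [gaussianPDFReal, hwc]
    have h1 : √(2 * Real.pi * (v / D)) = √(2 * Real.pi * v) * D ^ (-(1 / 2) : ℝ) := by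
      rw [← mul_div_assoc, Real.sqrt_div (by positivity), Real.rpow_neg ht.le, ← Real.sqrt_eq_rpow,
        div_eq_mul_inv]
    have h2 : D ^ (-(1 / 2) : ℝ) ≠ 0 := (Real.rpow_pos_of_pos ht _).ne'
    rw [h1, mul_inv, mul_assoc, ← Real.exp_add]
    have h3 : -(x - 0) ^ 2 / (2 * (v : ℝ)) + -t * (y - x) ^ 2 =
        -t * y ^ 2 / D + -(x - 2 * t * v * y / D) ^ 2 / (2 * (v / D)) := by
      have := ht.ne'
      field_simp
      rw [hD]; ring
    rw [h3, Real.exp_add]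
    field_simp
  simp_rw [key]
  rw [lintegral_const_mul _ (measurable_gaussianPDF _ _), lintegral_gaussianPDF_eq_one _ hw,
    mul_one]

lemma lintegral_exp_energy_sub_noiseLaw {n : ℕ} {v : ℝ} (hv : 0 ≤ v) (t : ℝ) (y : Fin n → ℝ)
    (ht : 0 < 1 + 2 * t * v) :
    ∫⁻ x, ENNReal.ofReal (Real.exp (-t * energy (y - x))) ∂(noiseLaw n v) =
      ENNReal.ofReal ((1 + 2 * t * v) ^ (-(n : ℝ) / 2) *
        Real.exp (-t * energy y / (1 + 2 * t * v))) := by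
  have hv' : ((v.toNNReal : ℝ≥0) : ℝ) = v := Real.coe_toNNReal _ hv
  have h1 : ∀ x : Fin n → ℝ, ENNReal.ofReal (Real.exp (-t * energy (y - x))) =
      ∏ l, ENNReal.ofReal (Real.exp (-t * (y l - x l) ^ 2)) := by
    intro x
    rw [← ENNReal.ofReal_prod_of_nonneg (fun _ _ => (Real.exp_pos _).le), ← Real.exp_sum,
      energy, Finset.mul_sum]
    simp
  simp_rw [h1]
  have hind : iIndepFun (fun (l : Fin n) (x : Fin n → ℝ) =>
      ENNReal.ofReal (Real.exp (-t * (y l - x l) ^ 2))) (noiseLaw n v) :=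
    iIndepFun_pi (X := fun l (x : ℝ) => ENNReal.ofReal (Real.exp (-t * (y l - x) ^ 2)))
      fun l => by fun_prop
  rw [lintegral_prod_eq_prod_lintegral_of_indepFun _ _ hind fun l => by fun_prop]
  have h2 : ∀ l, ∫⁻ x, ENNReal.ofReal (Real.exp (-t * (y l - x l) ^ 2)) ∂(noiseLaw n v) =
      ENNReal.ofReal ((1 + 2 * t * v) ^ (-(1 / 2) : ℝ) *
        Real.exp (-t * y l ^ 2 / (1 + 2 * t * v))) := by
    intro l
    have := lintegral_exp_sq_sub_gaussianReal v.toNNReal t (y l) (by rwa [hv'])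
    rw [hv'] at this
    rw [← this]
    exact (measurePreserving_eval (fun _ : Fin n => gaussianReal 0 v.toNNReal) l).lintegral_comp
      (f := fun x => ENNReal.ofReal (Real.exp (-t * (y l - x) ^ 2))) (by fun_prop)
  simp_rw [h2]
  rw [← ENNReal.ofReal_prod_of_nonneg (fun _ _ => by positivity), Finset.prod_mul_distrib,
    ← Real.exp_sum, Finset.prod_const, Finset.card_univ, Fintype.card_fin, ← Real.rpow_natCast,
    ← Real.rpow_mul ht.le, energy, Finset.mul_sum, Finset.sum_div]
  congr 3
  ring

/-- The energy of a Gaussian vector has the moment generating function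
`s ↦ (1 - 2 s v) ^ (-n / 2)`. -/
lemma lintegral_exp_energy_noiseLaw {n : ℕ} {v : ℝ} (hv : 0 ≤ v) (s : ℝ)
    (hs : 0 < 1 - 2 * s * v) :
    ∫⁻ x, ENNReal.ofReal (Real.exp (s * energy x)) ∂(noiseLaw n v) =
      ENNReal.ofReal ((1 - 2 * s * v) ^ (-(n : ℝ) / 2)) := by
  have h := lintegral_exp_energy_sub_noiseLaw (n := n) hv (-s) 0 (by linarith)
  have e : ∀ x : Fin n → ℝ, energy (0 - x) = energy x := fun x => by simp [energy]
  simp_rw [e] at h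
  simpa [energy, sub_eq_add_neg] using h

/-- The law of a sum of independent Gaussian noise vectors. -/
lemma noiseLaw_conv_noiseLaw {n : ℕ} {a b : ℝ} (ha : 0 ≤ a) (hb : 0 ≤ b) :
    noiseLaw n a ∗ noiseLaw n b = noiseLaw n (a + b) := by
  have h := (measurePreserving_arrowProdEquivProdArrow ℝ ℝ (Fin n)
    (fun _ => gaussianReal 0 a.toNNReal) (fun _ => gaussianReal 0 b.toNNReal)).map_eq
  unfold Measure.conv noiseLaw
  rw [← h, Measure.map_map (by fun_prop) (MeasurableEquiv.measurable _)]
  have e : (fun x : (Fin n → ℝ) × (Fin n → ℝ) => x.1 + x.2) ∘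
      (MeasurableEquiv.arrowProdEquivProdArrow ℝ ℝ (Fin n)) =
        fun x l => (fun z : ℝ × ℝ => z.1 + z.2) (x l) := by
    ext x l; rfl
  have hg : (gaussianReal 0 a.toNNReal).conv (gaussianReal 0 b.toNNReal) =
      gaussianReal 0 (a + b).toNNReal := by
    rw [gaussianReal_conv_gaussianReal, Real.toNNReal_add ha hb, add_zero]
  rw [e, Measure.pi_map_pi (f := fun _ (z : ℝ × ℝ) => z.1 + z.2) (fun _ => by fun_prop)]
  congr 1
  ext1 l
  exact hg

/-! ### Large deviations of the energy -/

/-- Markov's inequality in the form that Chernoff bounds use. -/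
lemma measure_le_lintegral_exp {Ω : Type*} [MeasurableSpace Ω] {μ : Measure Ω} {p : Ω → Prop}
    {f : Ω → ℝ} (hf : Measurable f) (h : ∀ x, p x → 0 ≤ f x) :
    μ {x | p x} ≤ ∫⁻ x, ENNReal.ofReal (Real.exp (f x)) ∂μ := by
  refine meas_le_lintegral₀ (by fun_prop) fun x hx => ?_
  rw [ENNReal.one_le_ofReal, Real.one_le_exp_iff]
  exact h x hx

lemma rpow_neg_half_le_exp {n : ℕ} {D c : ℝ} (hD : 0 < D) (h : D⁻¹ ≤ Real.exp c) :
    D ^ (-(n : ℝ) / 2) ≤ Real.exp (n * c / 2) := by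
  have : D ^ (-(n : ℝ) / 2) = D⁻¹ ^ ((n : ℝ) / 2) := by
    rw [Real.inv_rpow hD.le, ← Real.rpow_neg hD.le, neg_div]
  rw [this, show (n : ℝ) * c / 2 = c * (n / 2) by ring, Real.exp_mul]
  exact Real.rpow_le_rpow (by positivity) h (by positivity)

/-- The exponential moment that gives the upper tail of the energy; `s = τ / (2 (2 + τ) v)` is the
parameter of the Chernoff bound. -/
lemma lintegral_exp_energy_noiseLaw_le {n : ℕ} {v τ : ℝ} (hv : 0 < v) (hτ : 0 < τ) (hτ1 : τ ≤ 1) :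
    ∫⁻ x, ENNReal.ofReal (Real.exp (τ / (2 * (2 + τ) * v) * (energy x - n * (v * (1 + τ)))))
      ∂(noiseLaw n v) ≤ ENNReal.ofReal (Real.exp (-(n * τ ^ 2 / 12))) := by
  set s := τ / (2 * (2 + τ) * v) with hs
  have hD : 1 - 2 * s * v = 2 / (2 + τ) := by rw [hs]; field_simp; ring
  have h1 : ∀ x : Fin n → ℝ, ENNReal.ofReal (Real.exp (s * (energy x - n * (v * (1 + τ))))) =
      ENNReal.ofReal (Real.exp (-(s * (n * (v * (1 + τ)))))) *
        ENNReal.ofReal (Real.exp (s * energy x)) := by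
    intro x
    rw [← ENNReal.ofReal_mul (Real.exp_pos _).le, ← Real.exp_add]
    ring_nf
  simp_rw [h1]
  rw [lintegral_const_mul _ (by fun_prop), lintegral_exp_energy_noiseLaw hv.le s
    (by rw [hD]; positivity), ← ENNReal.ofReal_mul (Real.exp_pos _).le, hD]
  apply ENNReal.ofReal_le_ofReal
  have h2 : (2 / (2 + τ) : ℝ)⁻¹ ≤ Real.exp (τ / 2) := by
    have := Real.add_one_le_exp (τ / 2)
    rw [inv_div]; linarith
  calc _ ≤ Real.exp (-(s * (n * (v * (1 + τ))))) * Real.exp (n * (τ / 2) / 2) := by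
        gcongr; exact rpow_neg_half_le_exp (by positivity) h2
    _ = Real.exp (-(n * (τ ^ 2 / (4 * (2 + τ))))) := by
        rw [← Real.exp_add, hs]; congr 1; field_simp; ring
    _ ≤ _ := by
        apply Real.exp_le_exp.2
        have : τ ^ 2 / 12 ≤ τ ^ 2 / (4 * (2 + τ)) := by
          apply div_le_div_of_nonneg_left (by positivity) (by positivity) (by linarith)
        rw [mul_div_assoc]
        gcongr

lemma noiseLaw_energy_gt_le {n : ℕ} {v τ : ℝ} (hv : 0 < v) (hτ : 0 < τ) (hτ1 : τ ≤ 1) :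
    noiseLaw n v {x | n * (v * (1 + τ)) < energy x} ≤
      ENNReal.ofReal (Real.exp (-(n * τ ^ 2 / 12))) := by
  refine le_trans ?_ (lintegral_exp_energy_noiseLaw_le hv hτ hτ1)
  refine measure_le_lintegral_exp (by fun_prop) fun x hx => ?_
  exact mul_nonneg (by positivity) (by linarith)

lemma noiseLaw_energy_lt_le {n : ℕ} {v τ : ℝ} (hv : 0 < v) (hτ : 0 < τ) :
    noiseLaw n v {x | energy x < n * (v * (1 - τ))} ≤
      ENNReal.ofReal (Real.exp (-(n * τ ^ 2 / 12))) := by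
  -- a parameter for which elementary bounds give the exponent `-n τ² / 8`
  set s := τ / (4 * v) with hs
  have hs0 : 0 < s := by positivity
  have hD : 1 - 2 * (-s) * v = 1 + τ / 2 := by rw [hs]; field_simp; ring
  have h0 : ∫⁻ x : Fin n → ℝ, ENNReal.ofReal (Real.exp (s * (n * (v * (1 - τ)) - energy x)))
      ∂(noiseLaw n v) ≤ ENNReal.ofReal (Real.exp (-(n * τ ^ 2 / 12))) := by
    have h1 : ∀ x : Fin n → ℝ, ENNReal.ofReal (Real.exp (s * (n * (v * (1 - τ)) - energy x))) =
        ENNReal.ofReal (Real.exp (s * (n * (v * (1 - τ))))) *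
          ENNReal.ofReal (Real.exp (-s * energy x)) := by
      intro x
      rw [← ENNReal.ofReal_mul (Real.exp_pos _).le, ← Real.exp_add]
      ring_nf
    simp_rw [h1]
    rw [lintegral_const_mul _ (by fun_prop), lintegral_exp_energy_noiseLaw hv.le (-s)
      (by rw [hD]; positivity), ← ENNReal.ofReal_mul (Real.exp_pos _).le, hD]
    apply ENNReal.ofReal_le_ofReal
    have h2 : (1 + τ / 2 : ℝ)⁻¹ ≤ Real.exp (-(τ / 2) + τ ^ 2 / 4) := by
      refine le_trans ?_ (Real.add_one_le_exp _)
      rw [inv_le_iff_one_le_mul₀ (by positivity)]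
      nlinarith [pow_pos hτ 3]
    calc _ ≤ Real.exp (s * (n * (v * (1 - τ)))) *
          Real.exp (n * (-(τ / 2) + τ ^ 2 / 4) / 2) := by
          gcongr; exact rpow_neg_half_le_exp (by positivity) h2
      _ = Real.exp (-(n * τ ^ 2 / 8)) := by
          rw [← Real.exp_add, hs]; congr 1; field_simp; ring
      _ ≤ _ := by
          apply Real.exp_le_exp.2
          have : 0 ≤ n * τ ^ 2 := by positivity
          linarith
  refine le_trans ?_ h0
  refine measure_le_lintegral_exp (by fun_prop) fun x hx => ?_
  exact mul_nonneg (by positivity) (by linarith)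

/-! ### The threshold test -/

/-- The statistic by which a receiver tests a candidate word `x` of power `p` against the output
`y`, the noise having variance `ν`. Up to the constant `(n / 2) log (1 + p / ν)` it is minus the
information density of the pair `(x, y)`; for the true word it is about `0`. -/
noncomputable def score {n : ℕ} (p ν : ℝ) (y x : Fin n → ℝ) : ℝ :=
  energy (y - x) / (2 * ν) - energy y / (2 * (p + ν))

@[fun_prop]
lemma measurable_score {n : ℕ} {Ω : Type*} [MeasurableSpace Ω] {p ν : ℝ} {y x : Ω → Fin n → ℝ}
    (hy : Measurable y) (hx : Measurable x) : Measurable fun ω => score p ν (y ω) (x ω) := by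
  unfold score; fun_prop

/-- The bound `exp (n τ) (1 + p / ν) ^ (-n / 2)` for the probability that a word of power `p` that
is independent of the output passes the test with threshold `n τ`. -/
noncomputable def falseAlarm (n : ℕ) (p ν τ : ℝ) : ℝ :=
  Real.exp (n * τ) * (1 + p / ν) ^ (-(n : ℝ) / 2)

lemma falseAlarm_nonneg {n : ℕ} {p ν τ : ℝ} (hp : 0 ≤ p) (hν : 0 < ν) :
    0 ≤ falseAlarm n p ν τ := by
  unfold falseAlarm; positivity

/-- For every fixed output `y`, the expectation of `exp (-score)` over the word is exactly
`(1 + p / ν) ^ (-n / 2)`. -/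
lemma noiseLaw_score_le {n : ℕ} {p ν τ : ℝ} (hp : 0 ≤ p) (hν : 0 < ν) (y : Fin n → ℝ) :
    noiseLaw n p {x | score p ν y x ≤ n * τ} ≤ ENNReal.ofReal (falseAlarm n p ν τ) := by
  have hD : 1 + 2 * (1 / (2 * ν)) * p = 1 + p / ν := by field_simp
  have hD' : 0 < 1 + p / ν := by positivity
  have h0 : ∫⁻ x : Fin n → ℝ, ENNReal.ofReal (Real.exp (n * τ - score p ν y x)) ∂(noiseLaw n p) =
      ENNReal.ofReal (falseAlarm n p ν τ) := by
    have h1 : ∀ x : Fin n → ℝ, ENNReal.ofReal (Real.exp (n * τ - score p ν y x)) =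
        ENNReal.ofReal (Real.exp (n * τ + energy y / (2 * (p + ν)))) *
          ENNReal.ofReal (Real.exp (-(1 / (2 * ν)) * energy (y - x))) := by
      intro x
      rw [← ENNReal.ofReal_mul (Real.exp_pos _).le, ← Real.exp_add, score]
      ring_nf
    simp_rw [h1]
    rw [lintegral_const_mul _ (by fun_prop), lintegral_exp_energy_sub_noiseLaw hp _ _
      (by rw [hD]; positivity), ← ENNReal.ofReal_mul (Real.exp_pos _).le, hD, falseAlarm]
    congr 1
    rw [mul_left_comm, ← Real.exp_add, mul_comm]
    congr 2
    have : p + ν ≠ 0 := by positivity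
    have h3 : 1 + p / ν = (p + ν) / ν := by field_simp; ring
    rw [h3]
    field_simp
    ring
  rw [← h0]
  refine measure_le_lintegral_exp (by fun_prop) fun x hx => ?_
  linarith

section Test

variable {Ω : Type*} [MeasurableSpace Ω] {μ : Measure Ω}

lemma measure_score_le_of_indepFun [IsProbabilityMeasure μ] {n : ℕ} {p ν τ : ℝ} (hp : 0 ≤ p)
    (hν : 0 < ν) {A B : Ω → Fin n → ℝ} (hA : Measurable A) (hB : HasLaw B (noiseLaw n p) μ)
    (hAB : IndepFun A B μ) (z : Fin n → ℝ) :
    μ {ω | score p ν (A ω + z) (B ω) ≤ n * τ} ≤ ENNReal.ofReal (falseAlarm n p ν τ) := by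
  have hprod := (indepFun_iff_map_prod_eq_prod_map_map hA.aemeasurable hB.aemeasurable).1 hAB
  have hS : MeasurableSet {q : (Fin n → ℝ) × (Fin n → ℝ) | score p ν (q.1 + z) q.2 ≤ n * τ} :=
    measurableSet_le (by fun_prop) (by fun_prop)
  have : IsProbabilityMeasure (μ.map A) := Measure.isProbabilityMeasure_map hA.aemeasurable
  calc μ {ω | score p ν (A ω + z) (B ω) ≤ n * τ}
      = μ.map (fun ω => (A ω, B ω)) {q | score p ν (q.1 + z) q.2 ≤ n * τ} :=
        (Measure.map_apply_of_aemeasurable (hA.aemeasurable.prodMk hB.aemeasurable) hS).symm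
    _ = ∫⁻ a, noiseLaw n p {b | score p ν (a + z) b ≤ n * τ} ∂(μ.map A) := by
        rw [hprod, hB.map_eq, Measure.prod_apply hS]; rfl
    _ ≤ ∫⁻ _, ENNReal.ofReal (falseAlarm n p ν τ) ∂(μ.map A) :=
        lintegral_mono fun a => noiseLaw_score_le hp hν _
    _ = _ := by simp

/-- The true word passes the test, except when the noise has too much energy or the output too
little. -/
lemma measure_score_gt_le {n : ℕ} {p ν τ : ℝ} (hp : 0 ≤ p) (hν : 0 < ν) (hτ : 0 < τ)
    (hτ1 : τ ≤ 1) {Y X : Ω → Fin n → ℝ} (hZ : HasLaw (fun ω => Y ω - X ω) (noiseLaw n ν) μ)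
    (hY : HasLaw Y (noiseLaw n (p + ν)) μ) :
    μ {ω | n * τ < score p ν (Y ω) (X ω)} ≤
      2 * ENNReal.ofReal (Real.exp (-(n * τ ^ 2 / 12))) := by
  have hpν : 0 < p + ν := by positivity
  have hsub : {ω | n * τ < score p ν (Y ω) (X ω)} ⊆
      {ω | n * (ν * (1 + τ)) < energy (Y ω - X ω)} ∪
        {ω | energy (Y ω) < n * ((p + ν) * (1 - τ))} := by
    intro ω hω
    by_contra hcon
    simp only [Set.mem_union, Set.mem_ofPred_eq, not_or, not_lt] at hcon hω
    have h1 : energy (Y ω - X ω) / (2 * ν) ≤ n * (1 + τ) / 2 := by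
      rw [div_le_iff₀ (by positivity)]; linarith [hcon.1]
    have h2 : n * (1 - τ) / 2 ≤ energy (Y ω) / (2 * (p + ν)) := by
      rw [le_div_iff₀ (by positivity)]; linarith [hcon.2]
    rw [score] at hω
    linarith
  refine (measure_mono hsub).trans ((measure_union_le _ _).trans ?_)
  rw [two_mul]
  refine add_le_add ?_ ?_
  · have h := noiseLaw_energy_gt_le (n := n) hν hτ hτ1
    rwa [← hZ.map_eq, Measure.map_apply_of_aemeasurable hZ.aemeasurable
      (measurableSet_lt (by fun_prop) (by fun_prop))] at h
  · have h := noiseLaw_energy_lt_le (n := n) hpν hτ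
    rwa [← hY.map_eq, Measure.map_apply_of_aemeasurable hY.aemeasurable
      (measurableSet_lt (by fun_prop) (by fun_prop))] at h

end Test

/-! ### From random codes to codes -/

lemma one_le_numMessages (n : ℕ) (r : ℝ) : 1 ≤ numMessages n r :=
  Nat.one_le_ceil_iff.2 (by positivity)

instance (n : ℕ) (r : ℝ) : NeZero (numMessages n r) :=
  ⟨(Nat.lt_of_lt_of_le Nat.one_pos (one_le_numMessages n r)).ne'⟩

section Code

variable {G : SideInfoGraph} {P : ℝ} {R N : Fin 3 → ℝ} {n : ℕ}

/-- The part of the message triple `m` that receiver `i` knows. -/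
def known (G : SideInfoGraph) (i : Fin 3) (m : Messages n R) : SideInfo G n R i := fun j => m j

lemma Code.ofReal_errorProb (c : Code G P R n) (i : Fin 3) :
    ENNReal.ofReal (c.errorProb N i) = (∑ m : Messages n R,
      noiseLaw n (N i) {z | c.dec i (c.enc m + z) (known G i m) ≠ m i}) /
        (Fintype.card (Messages n R) : ℝ≥0∞) := by
  unfold Code.errorProb
  rw [ENNReal.ofReal_div_of_pos (by exact_mod_cast Fintype.card_pos),
    ENNReal.ofReal_sum_of_nonneg fun _ _ => measureReal_nonneg, ENNReal.ofReal_natCast]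
  congr 1
  exact Finset.sum_congr rfl fun m _ => ofReal_measureReal (measure_ne_top _ _)

/-- The code all of whose codewords are zero. -/
noncomputable def zeroCode (G : SideInfoGraph) (hP : 0 ≤ P) (R : Fin 3 → ℝ) (n : ℕ) :
    Code G P R n where
  enc _ := 0
  dec _ _ _ := 0
  measurable_dec _ _ := measurable_const
  power := by simpa using by positivity

/-- The probabilistic method: a random code whose expected error probabilities and whose
probability of violating the power constraint add up to less than `1` has a realization that is a
good code. -/
theorem exists_code_of_random_code {Ω : Type*} [MeasurableSpace Ω] (μ : Measure Ω)
    [IsProbabilityMeasure μ] (enc : Ω → Messages n R → Fin n → ℝ)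
    (henc : ∀ m, Measurable fun ω => enc ω m)
    (dec : Ω → (i : Fin 3) → (Fin n → ℝ) → SideInfo G n R i → Fin (numMessages n (R i)))
    (hdec : ∀ i s, Measurable fun q : Ω × (Fin n → ℝ) => dec q.1 i q.2 s)
    (B : Fin 3 → ℝ≥0∞) (b : ℝ≥0∞)
    (herr : ∀ i m, (μ.prod (noiseLaw n (N i)))
      {q | dec q.1 i (enc q.1 m + q.2) (known G i m) ≠ m i} ≤ B i)
    (hpow : μ {ω | n * P < (∑ m, energy (enc ω m)) / Fintype.card (Messages n R)} ≤ b)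
    (hlt : ∑ i, B i + b < 1) :
    ∃ c : Code G P R n, ∀ i, ENNReal.ofReal (c.errorProb N i) ≤ ∑ i, B i + b := by
  set M : ℝ≥0∞ := (Fintype.card (Messages n R) : ℝ≥0∞) with hM
  have hM0 : M ≠ 0 := Nat.cast_ne_zero.2 Fintype.card_ne_zero
  set bad : Set Ω := {ω | n * P < (∑ m, energy (enc ω m)) / Fintype.card (Messages n R)} with hbad
  have hbadm : MeasurableSet bad := measurableSet_lt (by fun_prop) (by fun_prop)
  have hE : ∀ i m, MeasurableSet {q : Ω × (Fin n → ℝ) |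
      dec q.1 i (enc q.1 m + q.2) (known G i m) ≠ m i} := by
    intro i m
    have h1 : Measurable fun q : Ω × (Fin n → ℝ) =>
        dec q.1 i (enc q.1 m + q.2) (known G i m) :=
      (hdec i (known G i m)).comp (f := fun q : Ω × (Fin n → ℝ) => (q.1, enc q.1 m + q.2))
        (by fun_prop)
    exact (measurableSet_eq_fun h1 measurable_const).compl
  -- the error probability of receiver `i`, as a function of the codebook
  let err : Fin 3 → Ω → ℝ≥0∞ := fun i ω =>
    (∑ m, noiseLaw n (N i) {z | dec ω i (enc ω m + z) (known G i m) ≠ m i}) / M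
  have herrm : ∀ i m, Measurable fun ω =>
      noiseLaw n (N i) {z | dec ω i (enc ω m + z) (known G i m) ≠ m i} :=
    fun i m => measurable_measure_prodMk_left (hE i m)
  have herrm' : ∀ i, Measurable (err i) := fun i =>
    (Finset.measurable_sum _ fun m _ => herrm i m).div_const M
  have hint : ∀ i, ∫⁻ ω, err i ω ∂μ ≤ B i := by
    intro i
    simp only [err, div_eq_mul_inv]
    rw [lintegral_mul_const _ (Finset.measurable_sum _ fun m _ => herrm i m),
      lintegral_finsetSum _ fun m _ => herrm i m, ← div_eq_mul_inv]
    refine ENNReal.div_le_of_le_mul ?_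
    calc _ ≤ ∑ _m : Messages n R, B i := Finset.sum_le_sum fun m _ => by
          have h := herr i m
          rwa [Measure.prod_apply (hE i m)] at h
      _ = B i * M := by simp [hM, mul_comm]
  have hF : Measurable fun ω => ∑ i, err i ω + bad.indicator 1 ω :=
    (Finset.measurable_sum _ fun i _ => herrm' i).add (measurable_one.indicator hbadm)
  have hFint : ∫⁻ ω, (∑ i, err i ω + bad.indicator 1 ω) ∂μ ≤ ∑ i, B i + b := by
    rw [lintegral_add_right _ (measurable_one.indicator hbadm),
      lintegral_finsetSum _ fun i _ => herrm' i, lintegral_indicator_one hbadm]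
    exact add_le_add (Finset.sum_le_sum fun i _ => hint i) hpow
  obtain ⟨ω, hω⟩ := exists_le_lintegral (μ := μ) hF.aemeasurable
  replace hω := hω.trans hFint
  have hgood : ω ∉ bad := by
    intro h
    rw [Set.indicator_of_mem h, Pi.one_apply] at hω
    exact absurd (le_add_self.trans hω) (not_le.2 hlt)
  refine ⟨⟨enc ω, dec ω, fun i s => (hdec i s).comp measurable_prodMk_left, ?_⟩, fun i => ?_⟩
  · simp only [hbad, Set.mem_ofPred_eq, not_lt] at hgood
    refine le_trans (le_of_eq ?_) hgood
    simp only [energy]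
    rw [← Finset.sum_div, Finset.sum_comm]
  · rw [Code.ofReal_errorProb]
    refine le_trans ?_ hω
    exact le_add_right (Finset.single_le_sum (f := fun i => err i ω) (fun _ _ => zero_le)
      (Finset.mem_univ i))

/-! ### Decoding by tests -/

section Decoder

variable {Λ : Type} (lab : Messages n R → Λ)

open Classical in
/-- The decoder of receiver `i` that tests the labels `lab m'` of the message triples `m'` that
agree with its side information, and outputs the `i`-th message of some triple whose label passes
the test `acc`. -/
noncomputable def testDecoder (G : SideInfoGraph) (i : Fin 3) (acc : Λ → Prop)
    (s : SideInfo G n R i) : Fin (numMessages n (R i)) :=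
  if h : ∃ m' : Messages n R, known G i m' = s ∧ acc (lab m') then h.choose i else 0

open Classical in
/-- The labels that, if they pass the test, can lead receiver `i` to a wrong message when `m` is
sent. -/
noncomputable def rivals (G : SideInfoGraph) (i : Fin 3) (m : Messages n R) : Finset Λ :=
  (Finset.univ.filter fun m' : Messages n R =>
    known G i m' = known G i m ∧ m' i ≠ m i).image lab

lemma mem_rivals {i : Fin 3} {m : Messages n R} {l : Λ} :
    l ∈ rivals lab G i m ↔
      ∃ m' : Messages n R, known G i m' = known G i m ∧ m' i ≠ m i ∧ lab m' = l := by
  simp [rivals, and_assoc]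

lemma not_accept_or_exists_rival {i : Fin 3} {acc : Λ → Prop} {m : Messages n R}
    (h : testDecoder lab G i acc (known G i m) ≠ m i) :
    ¬ acc (lab m) ∨ ∃ l ∈ rivals lab G i m, acc l := by
  by_contra! hcon
  obtain ⟨h1, h2⟩ := hcon
  have hex : ∃ m' : Messages n R, known G i m' = known G i m ∧ acc (lab m') := ⟨m, rfl, h1⟩
  rw [testDecoder, dif_pos hex] at h
  exact h2 _ ((mem_rivals lab).2 ⟨_, hex.choose_spec.1, h, rfl⟩) hex.choose_spec.2

lemma measurable_testDecoder [Finite Λ] {Ω : Type*} [MeasurableSpace Ω] {i : Fin 3}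
    {acc : Ω → Λ → Prop} (hacc : ∀ l, MeasurableSet {ω | acc ω l}) (s : SideInfo G n R i) :
    Measurable fun ω => testDecoder lab G i (acc ω) s := by
  have h : Measurable acc := measurable_pi_iff.2 fun l => measurableSet_setOfPred.1 (hacc l)
  exact (Measurable.of_discrete (f := fun a => testDecoder lab G i a s)).comp h

/-- The union bound for the decoder that tests. -/
lemma measure_testDecoder_ne_le {Ω : Type*} [MeasurableSpace Ω] (μ : Measure Ω) {i : Fin 3}
    {acc : Ω → Λ → Prop} (m : Messages n R) :
    μ {ω | testDecoder lab G i (acc ω) (known G i m) ≠ m i} ≤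
      μ {ω | ¬ acc ω (lab m)} + ∑ l ∈ rivals lab G i m, μ {ω | acc ω l} := by
  have hsub : {ω | testDecoder lab G i (acc ω) (known G i m) ≠ m i} ⊆
      {ω | ¬ acc ω (lab m)} ∪ ⋃ l ∈ rivals lab G i m, {ω | acc ω l} := by
    intro ω hω
    rcases not_accept_or_exists_rival lab (acc := acc ω) hω with h | ⟨l, hl, h⟩
    · exact Or.inl h
    · exact Or.inr (Set.mem_biUnion hl h)
  exact (measure_mono hsub).trans ((measure_union_le _ _).trans
    (add_le_add le_rfl (measure_biUnion_finset_le _ _)))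

end Decoder

end Code

/-! ### The Gaussian superposition codebook -/

/-- The bound `exp (-n τ² / 12)` for the large deviations of the energy. -/
noncomputable def tail (n : ℕ) (τ : ℝ) : ℝ := Real.exp (-(n * τ ^ 2 / 12))

lemma measure_prod_le_of_forall_right {α β : Type*} [MeasurableSpace α] [MeasurableSpace β]
    {μ : Measure α} {ν : Measure β} [SFinite μ] [IsProbabilityMeasure ν] {p : α → β → Prop}
    (hp : MeasurableSet {q : α × β | p q.1 q.2}) {c : ℝ≥0∞} (h : ∀ z, μ {x | p x z} ≤ c) :
    μ.prod ν {q | p q.1 q.2} ≤ c := by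
  rw [Measure.prod_apply_symm hp]
  calc _ ≤ ∫⁻ _, c ∂ν := lintegral_mono fun z => h z
    _ = c := by simp

section Codebook

variable {W S : Type} {n : ℕ} {pu pv ν τ : ℝ}

/-- A superposition codebook: cloud centres, indexed by `W`, and satellites, indexed by `S`. -/
abbrev Codebook (W S : Type) (n : ℕ) := W ⊕ S → Fin n → ℝ

/-- The codeword of the satellite `s`, whose cloud is `w s`. -/
def superpose (w : S → W) (c : Codebook W S n) (s : S) : Fin n → ℝ :=
  c (Sum.inl (w s)) + c (Sum.inr s)

@[fun_prop]
lemma measurable_superpose (w : S → W) (s : S) :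
    Measurable fun c : Codebook W S n => superpose w c s := by
  unfold superpose; fun_prop

/-- The test for the receivers that decode both layers: the satellite is tested against what
remains of the output after its cloud centre is subtracted, and the whole codeword against the
output. -/
def JointAccept (pu pv ν τ : ℝ) (w : S → W) (c : Codebook W S n) (y : Fin n → ℝ) (s : S) : Prop :=
  score pv ν (y - c (Sum.inl (w s))) (c (Sum.inr s)) ≤ n * τ ∧
    score (pu + pv) ν y (superpose w c s) ≤ n * τ

lemma measurableSet_jointAccept (w : S → W) (s : S) {Ω : Type*} [MeasurableSpace Ω]
    {c : Ω → Codebook W S n} {y : Ω → Fin n → ℝ} (hc : Measurable c) (hy : Measurable y) :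
    MeasurableSet {ω | JointAccept pu pv ν τ w (c ω) (y ω) s} := by
  have h := (measurable_superpose (n := n) w s).comp hc
  exact (measurableSet_le (measurable_score (by fun_prop) (by fun_prop)) measurable_const).inter
    (measurableSet_le (measurable_score hy h) measurable_const)

/-- The test for the receiver that decodes the cloud centre only, with the satellites as additional
noise of variance `pv`. -/
def CloudAccept (S : Type) (pu pv ν τ : ℝ) (c : Codebook W S n) (y : Fin n → ℝ) (k : W) : Prop :=
  score pu (pv + ν) y (c (Sum.inl k)) ≤ n * τ

lemma measurableSet_cloudAccept (k : W) {Ω : Type*} [MeasurableSpace Ω]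
    {c : Ω → Codebook W S n} {y : Ω → Fin n → ℝ} (hc : Measurable c) (hy : Measurable y) :
    MeasurableSet {ω | CloudAccept S pu pv ν τ (c ω) (y ω) k} :=
  measurableSet_le (by fun_prop) (by fun_prop)

variable [Fintype W] [Fintype S]

/-- The law of the random codebook: all coordinates are independent Gaussian variables, those of
the cloud centres with variance `pu` and those of the satellites with variance `pv`. -/
noncomputable def codebookLaw (W S : Type) [Fintype W] [Fintype S] (n : ℕ) (pu pv : ℝ) :
    Measure (Codebook W S n) :=
  Measure.pi fun i => noiseLaw n (Sum.elim (fun _ => pu) (fun _ => pv) i)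

instance : IsProbabilityMeasure (codebookLaw W S n pu pv) := by
  unfold codebookLaw; infer_instance

lemma iIndepFun_codebookLaw :
    iIndepFun (fun (i : W ⊕ S) (c : Codebook W S n) => c i) (codebookLaw W S n pu pv) :=
  iIndepFun_pi (X := fun _ => id) fun _ => aemeasurable_id

lemma hasLaw_centre (k : W) :
    HasLaw (fun c : Codebook W S n => c (Sum.inl k)) (noiseLaw n pu) (codebookLaw W S n pu pv) :=
  (measurePreserving_eval (fun i : W ⊕ S =>
    noiseLaw n (Sum.elim (fun _ => pu) (fun _ => pv) i)) (Sum.inl k)).hasLaw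

lemma hasLaw_satellite (s : S) :
    HasLaw (fun c : Codebook W S n => c (Sum.inr s)) (noiseLaw n pv) (codebookLaw W S n pu pv) :=
  (measurePreserving_eval (fun i : W ⊕ S =>
    noiseLaw n (Sum.elim (fun _ => pu) (fun _ => pv) i)) (Sum.inr s)).hasLaw

lemma hasLaw_superpose (hpu : 0 ≤ pu) (hpv : 0 ≤ pv) (w : S → W) (s : S) :
    HasLaw (fun c : Codebook W S n => superpose w c s) (noiseLaw n (pu + pv))
      (codebookLaw W S n pu pv) := by
  rw [← noiseLaw_conv_noiseLaw hpu hpv]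
  exact ((iIndepFun_codebookLaw (pu := pu) (pv := pv)).indepFun
    (i := Sum.inl (w s)) (j := Sum.inr s) (by simp)).hasLaw_fun_add (hasLaw_centre _)
      (hasLaw_satellite _)

lemma hasLaw_add_noise {Ω : Type*} [MeasurableSpace Ω] {μ : Measure Ω} [IsProbabilityMeasure μ]
    {p : ℝ} (hp : 0 ≤ p) (hν : 0 ≤ ν) {X : Ω → Fin n → ℝ} (hXm : Measurable X)
    (hX : HasLaw X (noiseLaw n p) μ) :
    HasLaw (fun q : Ω × (Fin n → ℝ) => X q.1 + q.2) (noiseLaw n (p + ν))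
      (μ.prod (noiseLaw n ν)) := by
  rw [← noiseLaw_conv_noiseLaw hp hν]
  exact (indepFun_prod hXm measurable_id).hasLaw_fun_add
    (hX.fun_comp (measurePreserving_fst.hasLaw)) measurePreserving_snd.hasLaw

lemma hasLaw_noise {Ω : Type*} [MeasurableSpace Ω] {μ : Measure Ω} [IsProbabilityMeasure μ] :
    HasLaw (fun q : Ω × (Fin n → ℝ) => q.2) (noiseLaw n ν) (μ.prod (noiseLaw n ν)) :=
  measurePreserving_snd.hasLaw

/-! ### The test of both layers -/

lemma measure_not_jointAccept_le (hpu : 0 ≤ pu) (hpv : 0 ≤ pv) (hν : 0 < ν) (hτ : 0 < τ)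
    (hτ1 : τ ≤ 1) (w : S → W) (s : S) :
    (codebookLaw W S n pu pv).prod (noiseLaw n ν)
      {q | ¬ JointAccept pu pv ν τ w q.1 (superpose w q.1 s + q.2) s} ≤
        4 * ENNReal.ofReal (tail n τ) := by
  set μ := (codebookLaw W S n pu pv).prod (noiseLaw n ν)
  have hsub : {q : Codebook W S n × (Fin n → ℝ) |
      ¬ JointAccept pu pv ν τ w q.1 (superpose w q.1 s + q.2) s} ⊆
      {q | n * τ < score pv ν (q.1 (Sum.inr s) + q.2) (q.1 (Sum.inr s))} ∪
        {q | n * τ < score (pu + pv) ν (superpose w q.1 s + q.2) (superpose w q.1 s)} := by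
    intro q hq
    by_contra hcon
    simp only [Set.mem_union, Set.mem_ofPred_eq, not_or, not_lt] at hcon hq
    refine hq ⟨?_, hcon.2⟩
    have : superpose w q.1 s + q.2 - q.1 (Sum.inl (w s)) = q.1 (Sum.inr s) + q.2 := by
      rw [superpose]; abel
    rw [this]; exact hcon.1
  refine (measure_mono hsub).trans ((measure_union_le _ _).trans ?_)
  rw [show (4 : ℝ≥0∞) = 2 + 2 by norm_num, add_mul]
  refine add_le_add ?_ ?_
  · refine measure_score_gt_le hpv hν hτ hτ1 ?_ ?_
    · simpa using hasLaw_noise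
    · exact hasLaw_add_noise hpv hν.le (by fun_prop) (hasLaw_satellite s)
  · refine measure_score_gt_le (by positivity) hν hτ hτ1 ?_ ?_
    · simpa using hasLaw_noise
    · exact hasLaw_add_noise (by positivity) hν.le (by fun_prop) (hasLaw_superpose hpu hpv w s)

/-- Against a satellite of the same cloud only the lower layer carries information. -/
lemma measure_jointAccept_le_of_cloud_eq (hpv : 0 ≤ pv) (hν : 0 < ν) (w : S → W) {s s' : S}
    (hs : s' ≠ s) (hw : w s' = w s) :
    (codebookLaw W S n pu pv).prod (noiseLaw n ν)
      {q | JointAccept pu pv ν τ w q.1 (superpose w q.1 s + q.2) s'} ≤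
        ENNReal.ofReal (falseAlarm n pv ν τ) := by
  refine measure_prod_le_of_forall_right
    (p := fun c z => JointAccept pu pv ν τ w c (superpose w c s + z) s')
    (measurableSet_jointAccept w s' (by fun_prop) (by fun_prop)) fun z => ?_
  refine (measure_mono ?_).trans (measure_score_le_of_indepFun (τ := τ) hpv hν
    (A := fun c : Codebook W S n => c (Sum.inr s)) (by fun_prop) (hasLaw_satellite s')
    ((iIndepFun_codebookLaw (pu := pu) (pv := pv)).indepFun (by simpa using hs.symm)) z)
  intro c hc
  have h := hc.1
  rwa [hw, superpose, add_assoc, add_sub_cancel_left] at h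

lemma measure_jointAccept_le_of_cloud_ne (hpu : 0 ≤ pu) (hpv : 0 ≤ pv) (hν : 0 < ν) (w : S → W)
    {s s' : S} (hw : w s' ≠ w s) :
    (codebookLaw W S n pu pv).prod (noiseLaw n ν)
      {q | JointAccept pu pv ν τ w q.1 (superpose w q.1 s + q.2) s'} ≤
        ENNReal.ofReal (falseAlarm n (pu + pv) ν τ) := by
  refine measure_prod_le_of_forall_right
    (p := fun c z => JointAccept pu pv ν τ w c (superpose w c s + z) s')
    (measurableSet_jointAccept w s' (by fun_prop) (by fun_prop)) fun z => ?_
  have hs : s' ≠ s := fun h => hw (h ▸ rfl)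
  have hind : IndepFun (fun c : Codebook W S n => superpose w c s)
      (fun c => superpose w c s') (codebookLaw W S n pu pv) :=
    iIndepFun_codebookLaw.indepFun_add_add (fun i => by fun_prop)
      (Sum.inl (w s)) (Sum.inr s) (Sum.inl (w s')) (Sum.inr s')
      (by simpa using hw.symm) (by simp) (by simp) (by simpa using hs.symm)
  refine (measure_mono ?_).trans (measure_score_le_of_indepFun (τ := τ) (by positivity) hν
    (A := fun c : Codebook W S n => superpose w c s) (by fun_prop)
    (hasLaw_superpose hpu hpv w s') hind z)
  exact fun c hc => hc.2

/-! ### The test of the cloud centres -/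

lemma measure_not_cloudAccept_le (hpu : 0 ≤ pu) (hpv : 0 ≤ pv) (hν : 0 < ν) (hτ : 0 < τ)
    (hτ1 : τ ≤ 1) (w : S → W) (s : S) :
    (codebookLaw W S n pu pv).prod (noiseLaw n ν)
      {q | ¬ CloudAccept S pu pv ν τ q.1 (superpose w q.1 s + q.2) (w s)} ≤
        2 * ENNReal.ofReal (tail n τ) := by
  have e : {q : Codebook W S n × (Fin n → ℝ) |
      ¬ CloudAccept S pu pv ν τ q.1 (superpose w q.1 s + q.2) (w s)} =
      {q | n * τ < score pu (pv + ν) (superpose w q.1 s + q.2) (q.1 (Sum.inl (w s)))} := by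
    ext q; simp [CloudAccept]
  rw [e]
  refine measure_score_gt_le hpu (by positivity) hτ hτ1 ?_ ?_
  · have h := hasLaw_add_noise hpv hν.le (by fun_prop)
      (hasLaw_satellite (W := W) (n := n) (pu := pu) (pv := pv) s)
    refine h.congr (ae_of_all _ fun q => ?_)
    simp only [superpose]; abel
  · rw [← add_assoc]
    exact hasLaw_add_noise (by positivity) hν.le (by fun_prop) (hasLaw_superpose hpu hpv w s)

lemma measure_cloudAccept_le_of_ne (hpu : 0 ≤ pu) (hpv : 0 ≤ pv) (hν : 0 < ν) (w : S → W)
    {s : S} {k : W} (hk : k ≠ w s) :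
    (codebookLaw W S n pu pv).prod (noiseLaw n ν)
      {q | CloudAccept S pu pv ν τ q.1 (superpose w q.1 s + q.2) k} ≤
        ENNReal.ofReal (falseAlarm n pu (pv + ν) τ) := by
  refine measure_prod_le_of_forall_right
    (p := fun c z => CloudAccept S pu pv ν τ c (superpose w c s + z) k)
    (measurableSet_cloudAccept k (by fun_prop) (by fun_prop)) fun z => ?_
  have hind : IndepFun (fun c : Codebook W S n => superpose w c s)
      (fun c => c (Sum.inl k)) (codebookLaw W S n pu pv) :=
    iIndepFun_codebookLaw.indepFun_add_left (fun i => by fun_prop)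
      (Sum.inl (w s)) (Sum.inr s) (Sum.inl k) (by simpa using hk.symm) (by simp)
  exact measure_score_le_of_indepFun (τ := τ) hpu (by positivity)
    (A := fun c : Codebook W S n => superpose w c s) (by fun_prop) (hasLaw_centre k) hind z

/-! ### The error probabilities of the receivers -/

section Receivers

variable {G : SideInfoGraph} {R : Fin 3 → ℝ} {e : Messages n R → S} {w : S → W}

/-- A receiver that decodes both layers errs with small probability if it has few enough rivals
with the right cloud centre, and few enough with a wrong one. -/
lemma measure_joint_error_le [DecidableEq W] (hpu : 0 ≤ pu) (hpv : 0 ≤ pv) (hν : 0 < ν) (hτ : 0 < τ)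
    (hτ1 : τ ≤ 1) {i : Fin 3} {m : Messages n R} (hne : ∀ s ∈ rivals e G i m, s ≠ e m) {a b : ℝ}
    (ha : (((rivals e G i m).filter fun s => w s = w (e m)).card : ℝ) ≤ a)
    (hb : (((rivals e G i m).filter fun s => w s ≠ w (e m)).card : ℝ) ≤ b) :
    (codebookLaw W S n pu pv).prod (noiseLaw n ν)
      {q | testDecoder e G i (JointAccept pu pv ν τ w q.1 (superpose w q.1 (e m) + q.2))
        (known G i m) ≠ m i} ≤
        ENNReal.ofReal (4 * tail n τ + a * falseAlarm n pv ν τ +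
          b * falseAlarm n (pu + pv) ν τ) := by
  have ha0 : 0 ≤ a := (Nat.cast_nonneg _).trans ha
  have hb0 : 0 ≤ b := (Nat.cast_nonneg _).trans hb
  have hf := falseAlarm_nonneg (n := n) (τ := τ) hpv hν
  have hf' := falseAlarm_nonneg (n := n) (τ := τ) (add_nonneg hpu hpv) hν
  have ht : 0 ≤ tail n τ := (Real.exp_pos _).le
  refine (measure_testDecoder_ne_le e _ m).trans ?_
  rw [← Finset.sum_filter_add_sum_filter_not _ (fun s => w s = w (e m)), ← add_assoc,
    ENNReal.ofReal_add (by positivity) (by positivity),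
    ENNReal.ofReal_add (by positivity) (by positivity)]
  refine add_le_add (add_le_add ?_ ?_) ?_
  · refine (measure_not_jointAccept_le hpu hpv hν hτ hτ1 w (e m)).trans (le_of_eq ?_)
    rw [ENNReal.ofReal_mul (by norm_num), ENNReal.ofReal_ofNat]
  · refine (Finset.sum_le_card_nsmul _ _ (ENNReal.ofReal (falseAlarm n pv ν τ))
      fun s hs => ?_).trans ?_
    · rw [Finset.mem_filter] at hs
      exact measure_jointAccept_le_of_cloud_eq hpv hν w (hne s hs.1) hs.2
    · rw [nsmul_eq_mul, ENNReal.ofReal_mul ha0, ← ENNReal.ofReal_natCast]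
      gcongr
  · refine (Finset.sum_le_card_nsmul _ _ (ENNReal.ofReal (falseAlarm n (pu + pv) ν τ))
      fun s hs => ?_).trans ?_
    · rw [Finset.mem_filter] at hs
      exact measure_jointAccept_le_of_cloud_ne hpu hpv hν w hs.2
    · rw [nsmul_eq_mul, ENNReal.ofReal_mul hb0, ← ENNReal.ofReal_natCast]
      gcongr

lemma measure_cloud_error_le (hpu : 0 ≤ pu) (hpv : 0 ≤ pv) (hν : 0 < ν) (hτ : 0 < τ)
    (hτ1 : τ ≤ 1) {i : Fin 3} {m : Messages n R}
    (hne : ∀ k ∈ rivals (w ∘ e) G i m, k ≠ w (e m)) {b : ℝ}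
    (hb : ((rivals (w ∘ e) G i m).card : ℝ) ≤ b) :
    (codebookLaw W S n pu pv).prod (noiseLaw n ν)
      {q | testDecoder (w ∘ e) G i (CloudAccept S pu pv ν τ q.1 (superpose w q.1 (e m) + q.2))
        (known G i m) ≠ m i} ≤
        ENNReal.ofReal (2 * tail n τ + b * falseAlarm n pu (pv + ν) τ) := by
  have hb0 : 0 ≤ b := (Nat.cast_nonneg _).trans hb
  have hf := falseAlarm_nonneg (n := n) (τ := τ) hpu (by positivity : 0 < pv + ν)
  have ht : 0 ≤ tail n τ := (Real.exp_pos _).le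
  refine (measure_testDecoder_ne_le (w ∘ e) _ m).trans ?_
  rw [ENNReal.ofReal_add (by positivity) (by positivity)]
  refine add_le_add ?_ ?_
  · refine (measure_not_cloudAccept_le hpu hpv hν hτ hτ1 w (e m)).trans (le_of_eq ?_)
    rw [ENNReal.ofReal_mul (by norm_num), ENNReal.ofReal_ofNat]
  · refine (Finset.sum_le_card_nsmul _ _ (ENNReal.ofReal (falseAlarm n pu (pv + ν) τ))
      fun k hk => ?_).trans ?_
    · exact measure_cloudAccept_le_of_ne hpu hpv hν w (hne k hk)
    · rw [nsmul_eq_mul, ENNReal.ofReal_mul hb0, ← ENNReal.ofReal_natCast]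
      gcongr

end Receivers

/-! ### The power constraint -/

/-- The average power of the random codebook is subject to the Chernoff bound of a single codeword,
because `exp` is convex; independence of the codewords plays no role. -/
lemma measure_power_gt_le {M : Type*} [Fintype M] [Nonempty M] {P : ℝ} (hpu : 0 ≤ pu)
    (hpv : 0 ≤ pv) (hp : 0 < pu + pv) (hτ : 0 < τ) (hτ1 : τ ≤ 1) (hP : (pu + pv) * (1 + τ) ≤ P)
    (w : S → W) (e : M → S) :
    codebookLaw W S n pu pv
      {c | n * P < (∑ m, energy (superpose w c (e m))) / Fintype.card M} ≤
        ENNReal.ofReal (tail n τ) := by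
  set v := pu + pv with hv
  set s := τ / (2 * (2 + τ) * v) with hs
  set K : ℝ := (Fintype.card M : ℝ) with hK
  have hK0 : 0 < K := Nat.cast_pos.2 Fintype.card_pos
  have hs0 : 0 ≤ s := by positivity
  let f : M → Codebook W S n → ℝ := fun m c =>
    s * (energy (superpose w c (e m)) - n * (v * (1 + τ)))
  have hfm : ∀ m, Measurable (f m) := fun m => by fun_prop
  have hfe : ∀ m, ∫⁻ c, ENNReal.ofReal (Real.exp (f m c)) ∂(codebookLaw W S n pu pv) ≤
      ENNReal.ofReal (tail n τ) := by
    intro m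
    have h := lintegral_exp_energy_noiseLaw_le (n := n) hp hτ hτ1
    rw [← (hasLaw_superpose hpu hpv w (e m)).lintegral_comp (by fun_prop)] at h
    exact h
  have hconv : ∀ c, Real.exp (∑ m, K⁻¹ * f m c) ≤ ∑ m, K⁻¹ * Real.exp (f m c) := by
    intro c
    have := convexOn_exp.map_sum_le (t := Finset.univ) (w := fun _ : M => K⁻¹)
      (p := fun m => f m c) (fun _ _ => by positivity)
      (by simp [hK]) (fun _ _ => Set.mem_univ _)
    simpa using this
  calc _ ≤ ∫⁻ c, ENNReal.ofReal (Real.exp (∑ m, K⁻¹ * f m c)) ∂(codebookLaw W S n pu pv) := by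
        refine measure_le_lintegral_exp (by fun_prop) fun c hc => ?_
        have h1 : ∑ m, K⁻¹ * f m c =
            s * ((∑ m, energy (superpose w c (e m))) / K - n * (v * (1 + τ))) := by
          rw [← Finset.mul_sum, ← Finset.mul_sum, Finset.sum_sub_distrib]
          simp only [Finset.sum_const, Finset.card_univ, nsmul_eq_mul, ← hK]
          field_simp
        rw [h1]
        have h2 : (n : ℝ) * (v * (1 + τ)) ≤ n * P := by gcongr
        exact mul_nonneg hs0 (by linarith)
    _ ≤ ∫⁻ c, ∑ m, ENNReal.ofReal K⁻¹ * ENNReal.ofReal (Real.exp (f m c))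
          ∂(codebookLaw W S n pu pv) := by
        refine lintegral_mono fun c => ?_
        refine (ENNReal.ofReal_le_ofReal (hconv c)).trans (le_of_eq ?_)
        rw [ENNReal.ofReal_sum_of_nonneg fun _ _ => by positivity]
        exact Finset.sum_congr rfl fun m _ => ENNReal.ofReal_mul (by positivity)
    _ = ∑ m, ENNReal.ofReal K⁻¹ *
          ∫⁻ c, ENNReal.ofReal (Real.exp (f m c)) ∂(codebookLaw W S n pu pv) := by
        rw [lintegral_finsetSum _ fun m _ => by fun_prop]
        exact Finset.sum_congr rfl fun m _ => lintegral_const_mul _ (by fun_prop)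
    _ ≤ ∑ _m : M, ENNReal.ofReal K⁻¹ * ENNReal.ofReal (tail n τ) := by
        gcongr with m; exact hfe m
    _ = ENNReal.ofReal (tail n τ) := by
        rw [Finset.sum_const, Finset.card_univ, nsmul_eq_mul, ← mul_assoc,
          ← ENNReal.ofReal_natCast, ← ENNReal.ofReal_mul (by positivity), ← hK,
          mul_inv_cancel₀ hK0.ne', ENNReal.ofReal_one, one_mul]

end Codebook

/-! ### Achievability by superposition -/

section Scheme

variable {G : SideInfoGraph} {P : ℝ} {R N : Fin 3 → ℝ}

/-- A code of fixed block length. Receivers `0` and `2` decode both layers, receiver `1` the cloud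
centre only. The message triple `m` is sent as the satellite `e m`, whose cloud is `w (e m)`. -/
theorem exists_code_of_superposition {n : ℕ} {W S : Type} [Fintype W] [DecidableEq W] [Fintype S]
    {pu pv τ : ℝ} (hN : ∀ i, 0 < N i) (hpu : 0 ≤ pu) (hpv : 0 ≤ pv) (hp : 0 < pu + pv)
    (hτ : 0 < τ) (hτ1 : τ ≤ 1) (hP : (pu + pv) * (1 + τ) ≤ P) (e : Messages n R → S) (w : S → W)
    (he : ∀ i ≠ 1, ∀ m, ∀ s ∈ rivals e G i m, s ≠ e m)
    (hw : ∀ m, ∀ k ∈ rivals (w ∘ e) G 1 m, k ≠ w (e m))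
    {a b : Fin 3 → ℝ}
    (ha : ∀ i ≠ 1, ∀ m, (((rivals e G i m).filter fun s => w s = w (e m)).card : ℝ) ≤ a i)
    (hb : ∀ i ≠ 1, ∀ m, (((rivals e G i m).filter fun s => w s ≠ w (e m)).card : ℝ) ≤ b i)
    (hb1 : ∀ m, ((rivals (w ∘ e) G 1 m).card : ℝ) ≤ b 1) {ε : ℝ}
    (hε : 11 * tail n τ + (a 0 * falseAlarm n pv (N 0) τ + b 0 * falseAlarm n (pu + pv) (N 0) τ) +
      b 1 * falseAlarm n pu (pv + N 1) τ +
      (a 2 * falseAlarm n pv (N 2) τ + b 2 * falseAlarm n (pu + pv) (N 2) τ) = ε) (hε1 : ε < 1) :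
    ∃ c : Code G P R n, ∀ i, c.errorProb N i ≤ ε := by
  have ht : 0 ≤ tail n τ := (Real.exp_pos _).le
  have m₀ : Messages n R := fun _ => 0
  have ha0 : ∀ i ≠ 1, 0 ≤ a i := fun i hi => (Nat.cast_nonneg _).trans (ha i hi m₀)
  have hb0 : ∀ i ≠ 1, 0 ≤ b i := fun i hi => (Nat.cast_nonneg _).trans (hb i hi m₀)
  have hb10 : 0 ≤ b 1 := (Nat.cast_nonneg _).trans (hb1 m₀)
  -- the bound for receiver `i`
  let B : Fin 3 → ℝ := fun i => if i = 1 then 2 * tail n τ + b 1 * falseAlarm n pu (pv + N 1) τ else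
    4 * tail n τ + a i * falseAlarm n pv (N i) τ + b i * falseAlarm n (pu + pv) (N i) τ
  have hB0 : ∀ i, 0 ≤ B i := by
    intro i
    have h1 := falseAlarm_nonneg (n := n) (τ := τ) hpu (add_pos_of_nonneg_of_pos hpv (hN 1))
    have h2 := falseAlarm_nonneg (n := n) (τ := τ) hpv (hN i)
    have h3 := falseAlarm_nonneg (n := n) (τ := τ) (add_nonneg hpu hpv) (hN i)
    by_cases hi : i = 1
    · simp only [B, if_pos hi]; positivity
    · have := ha0 i hi
      have := hb0 i hi
      simp only [B, if_neg hi]; positivity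
  have hsum : ∑ i, ENNReal.ofReal (B i) + ENNReal.ofReal (tail n τ) = ENNReal.ofReal ε := by
    rw [← ENNReal.ofReal_sum_of_nonneg fun i _ => hB0 i,
      ← ENNReal.ofReal_add (Finset.sum_nonneg fun i _ => hB0 i) ht, ← hε]
    congr 1
    simp [Fin.sum_univ_three, B]
    ring
  have hε0 : 0 ≤ ε := by
    have h1 := falseAlarm_nonneg (n := n) (τ := τ) hpu (add_pos_of_nonneg_of_pos hpv (hN 1))
    have h2 := fun i => falseAlarm_nonneg (n := n) (τ := τ) hpv (hN i)
    have h3 := fun i => falseAlarm_nonneg (n := n) (τ := τ) (add_nonneg hpu hpv) (hN i)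
    have := mul_nonneg (ha0 0 (by decide)) (h2 0)
    have := mul_nonneg (ha0 2 (by decide)) (h2 2)
    have := mul_nonneg (hb0 0 (by decide)) (h3 0)
    have := mul_nonneg (hb0 2 (by decide)) (h3 2)
    have := mul_nonneg hb10 h1
    linarith
  obtain ⟨c, hc⟩ := exists_code_of_random_code (G := G) (P := P) (R := R) (N := N)
    (codebookLaw W S n pu pv) (fun c m => superpose w c (e m)) (fun m => by fun_prop)
    (fun c i y s => if i = 1 then
      testDecoder (w ∘ e) G i (CloudAccept S pu pv (N 1) τ c y) s else
      testDecoder e G i (JointAccept pu pv (N i) τ w c y) s)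
    (by
      intro i s
      by_cases hi : i = 1
      · simp only [if_pos hi]
        exact measurable_testDecoder _
          (fun k => measurableSet_cloudAccept k measurable_fst measurable_snd) s
      · simp only [if_neg hi]
        exact measurable_testDecoder _
          (fun k => measurableSet_jointAccept w k measurable_fst measurable_snd) s)
    (fun i => ENNReal.ofReal (B i)) (ENNReal.ofReal (tail n τ))
    (by
      intro i m
      by_cases hi : i = 1
      · subst hi
        simp only [if_pos, B]
        exact measure_cloud_error_le hpu hpv (hN 1) hτ hτ1 (hw m) (hb1 m)
      · simp only [if_neg hi, B]
        exact measure_joint_error_le hpu hpv (hN i) hτ hτ1 (he i hi m) (ha i hi m) (hb i hi m))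
    (measure_power_gt_le hpu hpv hp hτ hτ1 hP w e)
    (by rw [hsum]; exact ENNReal.ofReal_lt_one.2 hε1)
  exact ⟨c, fun i => (ENNReal.ofReal_le_ofReal_iff hε0).1 (hsum ▸ hc i)⟩

lemma tendsto_tail {τ : ℝ} (hτ : 0 < τ) : Tendsto (fun n => tail n τ) atTop (𝓝 0) := by
  unfold tail
  refine Real.tendsto_exp_neg_atTop_nhds_zero.comp ?_
  have h := (tendsto_natCast_atTop_atTop (R := ℝ)).atTop_mul_const
    (show 0 < τ ^ 2 / 12 by positivity)
  exact h.congr fun n => by ring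

/-- Fewer than `2 ^ (n r)` rivals do no harm if `r` is below capacity. -/
lemma eventually_tendsto_mul_falseAlarm {p ν r : ℝ} (hp : 0 ≤ p) (hν : 0 < ν)
    (hr : r < gaussC (p / ν)) (K : ℝ) :
    ∀ᶠ τ in 𝓝[>] (0 : ℝ),
      Tendsto (fun n : ℕ => K * 2 ^ ((n : ℝ) * r) * falseAlarm n p ν τ) atTop (𝓝 0) := by
  have hl : 0 < Real.log 2 := Real.log_pos one_lt_two
  have hq : 0 < 1 + p / ν := by positivity
  have hg : gaussC (p / ν) * Real.log 2 = Real.log (1 + p / ν) / 2 := by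
    unfold gaussC Real.logb; field_simp
  have hgap : 0 < (gaussC (p / ν) - r) * Real.log 2 := mul_pos (by linarith) hl
  filter_upwards [Ioo_mem_nhdsGT hgap] with τ hτ
  have hκ : 0 < (gaussC (p / ν) - r) * Real.log 2 - τ := by linarith [hτ.2]
  have h := (Real.tendsto_exp_neg_atTop_nhds_zero.comp
    ((tendsto_natCast_atTop_atTop (R := ℝ)).atTop_mul_const hκ)).const_mul K
  rw [mul_zero] at h
  refine h.congr fun n => ?_
  rw [mul_assoc, falseAlarm, Real.rpow_def_of_pos two_pos, Real.rpow_def_of_pos hq, ← Real.exp_add,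
    ← Real.exp_add, Function.comp_apply]
  congr 2
  rw [sub_mul, hg]
  ring

/-- A family of superposition schemes achieves the rates `R` if the numbers of rivals grow at rates
below the capacities of the layers concerned: `ra i` is the rate of the rivals with the right cloud
centre, `rb i` the rate of those with a wrong one. -/
theorem achievable_of_superposition {pu pv : ℝ} (hP0 : 0 ≤ P) (hN : ∀ i, 0 < N i) (hpu : 0 ≤ pu)
    (hpv : 0 ≤ pv) (hp : 0 < pu + pv) (hP : pu + pv < P) {W S : ℕ → Type} [∀ n, Fintype (W n)]
    [∀ n, DecidableEq (W n)] [∀ n, Fintype (S n)] (e : ∀ n, Messages n R → S n) (w : ∀ n, S n → W n)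
    (he : ∀ n, ∀ i ≠ 1, ∀ m m' : Messages n R, known G i m' = known G i m → e n m' = e n m →
      m' i = m i)
    (hw : ∀ n, ∀ m m' : Messages n R, known G 1 m' = known G 1 m → w n (e n m') = w n (e n m) →
      m' 1 = m 1)
    {K : ℝ} {ra rb : Fin 3 → ℝ}
    (ha : ∀ n, ∀ i ≠ 1, ∀ m, (((rivals (e n) G i m).filter
      fun s => w n s = w n (e n m)).card : ℝ) ≤ K * 2 ^ ((n : ℝ) * ra i))
    (hb : ∀ n, ∀ i ≠ 1, ∀ m, ((rivals (e n) G i m).card : ℝ) ≤ K * 2 ^ ((n : ℝ) * rb i))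
    (hb1 : ∀ n, ∀ m, ((rivals (w n ∘ e n) G 1 m).card : ℝ) ≤ K * 2 ^ ((n : ℝ) * rb 1))
    (hra : ∀ i ≠ 1, ra i < gaussC (pv / N i)) (hrb : ∀ i ≠ 1, rb i < gaussC ((pu + pv) / N i))
    (hrb1 : rb 1 < gaussC (pu / (pv + N 1))) : Achievable G P N R := by
  -- one threshold that suits all receivers
  have hsmall : ∀ᶠ τ in 𝓝[>] (0 : ℝ), (pu + pv) * (1 + τ) ≤ P := by
    have h : Tendsto (fun τ : ℝ => (pu + pv) * (1 + τ)) (𝓝[>] 0) (𝓝 ((pu + pv) * (1 + 0))) :=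
      (Continuous.tendsto (by fun_prop) 0).mono_left nhdsWithin_le_nhds
    rw [add_zero, mul_one] at h
    exact (h.eventually_lt_const hP).mono fun _ h => h.le
  have hunit : ∀ᶠ τ in 𝓝[>] (0 : ℝ), τ ∈ Set.Ioc (0 : ℝ) 1 := Ioc_mem_nhdsGT one_pos
  have h0 : (0 : Fin 3) ≠ 1 := by decide
  have h2 : (2 : Fin 3) ≠ 1 := by decide
  obtain ⟨τ, hτ, hτP, ta0, tb0, tb1, ta2, tb2⟩ :=
    (hunit.and (hsmall.and
      ((eventually_tendsto_mul_falseAlarm hpv (hN 0) (hra 0 h0) K).and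
      ((eventually_tendsto_mul_falseAlarm hp.le (hN 0) (hrb 0 h0) K).and
      ((eventually_tendsto_mul_falseAlarm hpu (add_pos_of_nonneg_of_pos hpv (hN 1)) hrb1 K).and
      ((eventually_tendsto_mul_falseAlarm hpv (hN 2) (hra 2 h2) K).and
      (eventually_tendsto_mul_falseAlarm hp.le (hN 2) (hrb 2 h2) K))))))).exists
  have hlim := ((((tendsto_tail hτ.1).const_mul 11).add (ta0.add tb0)).add tb1).add (ta2.add tb2)
  simp only [mul_zero, add_zero] at hlim
  set ε : ℕ → ℝ := fun n => _ with hεdef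
  change Tendsto ε atTop (𝓝 0) at hlim
  have hcode : ∀ n, ε n < 1 → ∃ c : Code G P R n, ∀ i, c.errorProb N i ≤ ε n := fun n hn =>
    exists_code_of_superposition hN hpu hpv hp hτ.1 hτ.2 hτP (e n) (w n)
      (fun i hi m s hs hsm => by
        obtain ⟨m', h1, h2, rfl⟩ := (mem_rivals _).1 hs
        exact h2 (he n i hi m m' h1 hsm))
      (fun m k hk hkm => by
        obtain ⟨m', h1, h2, rfl⟩ := (mem_rivals _).1 hk
        exact h2 (hw n m m' h1 hkm))
      (a := fun i => K * 2 ^ ((n : ℝ) * ra i)) (b := fun i => K * 2 ^ ((n : ℝ) * rb i))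
      (ha n) (fun i hi m => (Nat.cast_le.2 (Finset.card_filter_le _ _)).trans (hb n i hi m))
      (hb1 n) rfl hn
  choose c hc using hcode
  refine ⟨fun n => if h : ε n < 1 then c n h else zeroCode G hP0 R n, fun i => ?_⟩
  refine squeeze_zero' (Eventually.of_forall fun n => ?_) ?_ hlim
  · unfold Code.errorProb
    exact div_nonneg (Finset.sum_nonneg fun _ _ => measureReal_nonneg) (Nat.cast_nonneg _)
  · filter_upwards [hlim.eventually_lt_const one_pos] with n hn
    rw [dif_pos hn]
    exact hc n hn i

end Scheme

/-! ### Capacities and numbers of messages -/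

lemma gaussC_nonneg {q : ℝ} (hq : 0 ≤ q) : 0 ≤ gaussC q :=
  mul_nonneg (by norm_num) (Real.logb_nonneg one_lt_two (by linarith))

lemma gaussC_mono {p q : ℝ} (hp : 0 ≤ p) (h : p ≤ q) : gaussC p ≤ gaussC q :=
  mul_le_mul_of_nonneg_left (Real.logb_le_logb_of_le one_lt_two (by linarith) (by linarith))
    (by norm_num)

/-- The chain rule for the two layers of a superposition code. -/
lemma gaussC_add_gaussC {pu pv ν : ℝ} (hpu : 0 ≤ pu) (hpv : 0 ≤ pv) (hν : 0 < ν) :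
    gaussC (pu / (pv + ν)) + gaussC (pv / ν) = gaussC ((pu + pv) / ν) := by
  unfold gaussC
  rw [← mul_add, ← Real.logb_mul (by positivity) (by positivity)]
  congr 2
  field_simp
  ring

lemma continuousAt_gaussC_comp {q : ℝ → ℝ} {x : ℝ} (hq : ContinuousAt q x) (h : 0 ≤ q x) :
    ContinuousAt (fun y => gaussC (q y)) x := by
  unfold gaussC Real.logb
  exact (((hq.const_add 1).log (by positivity)).div_const _).const_mul _

lemma numMessages_le {n : ℕ} {r : ℝ} (hr : 0 ≤ r) :
    (numMessages n r : ℝ) ≤ 2 * 2 ^ ((n : ℝ) * r) := by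
  have h1 : (1 : ℝ) ≤ 2 ^ ((n : ℝ) * r) := Real.one_le_rpow one_le_two (by positivity)
  have h2 := Nat.ceil_lt_add_one (zero_le_one.trans h1)
  unfold numMessages
  linarith

lemma le_numMessages (n : ℕ) (r : ℝ) : (2 : ℝ) ^ ((n : ℝ) * r) ≤ numMessages n r :=
  Nat.le_ceil _

lemma numMessages_mul_le {n : ℕ} {r r' : ℝ} (hr : 0 ≤ r) (hr' : 0 ≤ r') :
    (numMessages n r * numMessages n r' : ℝ) ≤ 4 * 2 ^ ((n : ℝ) * (r + r')) := by
  rw [mul_add, Real.rpow_add two_pos]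
  calc _ ≤ (2 * 2 ^ ((n : ℝ) * r)) * (2 * 2 ^ ((n : ℝ) * r') : ℝ) := by
        gcongr <;> exact numMessages_le ‹_›
    _ = _ := by ring

lemma le_two_rpow_sub_of_mul_numMessages_le {n : ℕ} {ρ r x K : ℝ}
    (h : x * numMessages n ρ ≤ K * 2 ^ ((n : ℝ) * r)) (hx : 0 ≤ x) :
    x ≤ K * 2 ^ ((n : ℝ) * (r - ρ)) := by
  rw [mul_sub, Real.rpow_sub two_pos, ← mul_div_assoc, le_div_iff₀ (by positivity)]
  exact (mul_le_mul_of_nonneg_left (le_numMessages n ρ) hx).trans h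

/-- Below `L` there are at most `L / A` numbers other than `x` that are congruent to `x`
modulo `A`. -/
lemma card_mul_le_of_modEq {α : Type*} {T : Finset α} (f : α → ℕ) (hf : Set.InjOn f T)
    {L A x : ℕ} (hx : x < L) (h : ∀ k ∈ T, f k < L ∧ f k ≡ x [MOD A] ∧ f k ≠ x) :
    T.card * A ≤ L := by
  have hdiv : ∀ a b : ℕ, a ≡ b [MOD A] → a / A = b / A → a = b := by
    intro a b h1 h2
    rw [← Nat.div_add_mod a A, ← Nat.div_add_mod b A, h2, h1]
  have hsub : T.image (fun k => f k / A) ⊆ (Finset.range ((L - 1) / A + 1)).erase (x / A) := by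
    intro j hj
    obtain ⟨k, hk, rfl⟩ := Finset.mem_image.1 hj
    obtain ⟨h1, h2, h3⟩ := h k hk
    rw [Finset.mem_erase, Finset.mem_range]
    exact ⟨fun h4 => h3 (hdiv _ _ h2 h4),
      Nat.lt_succ_of_le (Nat.div_le_div_right (by omega))⟩
  have hcard : (T.image (fun k => f k / A)).card = T.card := by
    refine Finset.card_image_of_injOn fun a ha b hb hab => hf ha hb ?_
    exact hdiv _ _ ((h a ha).2.1.trans (h b hb).2.1.symm) hab
  have h1 := Finset.card_le_card hsub
  rw [hcard, Finset.card_erase_of_mem (by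
    rw [Finset.mem_range]
    exact Nat.lt_succ_of_le (Nat.div_le_div_right (by omega))), Finset.card_range] at h1
  calc T.card * A ≤ (L - 1) / A * A := Nat.mul_le_mul_right _ (by simpa using h1)
    _ ≤ L - 1 := Nat.div_mul_le_self _ _
    _ ≤ L := Nat.sub_le _ _

/-! ### The graphs of group 7 -/

lemma IsGroup7Member.mem_two_zero {G : SideInfoGraph} (hG : IsGroup7Member G) : (2, 0) ∈ G := by
  obtain ⟨T, -, rfl⟩ := hG
  simp [groupLeader7]

lemma IsGroup7Member.mem_two_one {G : SideInfoGraph} (hG : IsGroup7Member G) : (2, 1) ∈ G := by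
  obtain ⟨T, -, rfl⟩ := hG
  simp [groupLeader7]

lemma IsGroup7Member.sumRate13_eq {G : SideInfoGraph} (hG : IsGroup7Member G) (R : Fin 3 → ℝ) :
    sumRate13 G R = R 0 + if (0, 2) ∈ G then 0 else R 2 := by
  have h0 : (0, 0) ∉ G := by
    obtain ⟨T, hT, rfl⟩ := hG
    intro h
    rcases Finset.mem_union.1 h with h | h
    · exact absurd h (by decide)
    · exact absurd (hT h) (by decide)
  have h0' : (0 : Fin 3) ∉ outNeighbors G 0 := by simpa [outNeighbors] using h0
  unfold sumRate13
  split_ifs with h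
  · have h2 : (2 : Fin 3) ∈ outNeighbors G 0 := by simpa [outNeighbors] using h
    rw [Finset.insert_sdiff_of_notMem _ h0', Finset.sdiff_eq_empty_iff_subset.2 (by simpa using h2)]
    simp
  · have h2 : (2 : Fin 3) ∉ outNeighbors G 0 := by simpa [outNeighbors] using h
    rw [Finset.insert_sdiff_of_notMem _ h0', Finset.sdiff_eq_self_of_disjoint (by simpa using h2),
      Finset.sum_pair (by decide)]

section Members

variable {G : SideInfoGraph} {P : ℝ} {R N : Fin 3 → ℝ} {n : ℕ}

lemma eq_of_known {i j : Fin 3} (h : (i, j) ∈ G) {m m' : Messages n R}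
    (hm : known G i m' = known G i m) : m' j = m j :=
  congrFun hm ⟨j, by simpa [outNeighbors] using h⟩

lemma messages_ext {m m' : Messages n R} (h0 : m 0 = m' 0) (h1 : m 1 = m' 1) (h2 : m 2 = m' 2) :
    m = m' := by
  funext i; fin_cases i <;> assumption

/-! ### The members without the arc `(1, 2)` -/

/-- The number whose residue is put into the cloud centre next to message `1`. If receiver `0`
knows message `2`, a sum serves both receiver `0`, who knows one summand, and receiver
`2`, who knows the other. Otherwise it is a position number of the pair `(m 0, m 2)`. -/
noncomputable def pairIndex (G : SideInfoGraph) (m : Messages n R) : ℕ :=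
  (if (0, 2) ∈ G then 1 else numMessages n (R 2)) * (m 0 : ℕ) + (m 2 : ℕ)

/-- The index of the cloud centre: message `1`, and a residue of `pairIndex`. -/
noncomputable def splitCloud (G : SideInfoGraph) (ρ : ℝ) (m : Messages n R) :
    Fin (numMessages n (R 1)) × ZMod (numMessages n ρ) :=
  (m 1, (pairIndex G m : ZMod (numMessages n ρ)))

lemma splitCloud_eq_iff {ρ : ℝ} {m m' : Messages n R} :
    splitCloud G ρ m' = splitCloud G ρ m ↔
      m' 1 = m 1 ∧ pairIndex G m' ≡ pairIndex G m [MOD numMessages n ρ] := by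
  rw [splitCloud, splitCloud, Prod.mk.injEq, ZMod.natCast_eq_natCast_iff]

lemma card_rivals_split_zero_le (hG : IsGroup7Member G) (hR : ∀ i, 0 ≤ R i) (ρ : ℝ)
    (m : Messages n R) :
    (((rivals id G 0 m).filter fun s => splitCloud G ρ s = splitCloud G ρ m).card : ℝ) ≤
      8 * 2 ^ ((n : ℝ) * (sumRate13 G R - ρ)) := by
  have hmem : ∀ s ∈ (rivals id G 0 m).filter fun s => splitCloud G ρ s = splitCloud G ρ m,
      known G 0 s = known G 0 m ∧ s 0 ≠ m 0 ∧ s 1 = m 1 ∧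
        pairIndex G s ≡ pairIndex G m [MOD numMessages n ρ] := by
    intro s hs
    rw [Finset.mem_filter, mem_rivals, splitCloud_eq_iff] at hs
    obtain ⟨⟨m', h1, h2, rfl⟩, h3⟩ := hs
    exact ⟨h1, h2, h3⟩
  refine le_two_rpow_sub_of_mul_numMessages_le ?_ (Nat.cast_nonneg _)
  rw [hG.sumRate13_eq]
  by_cases h : (0, 2) ∈ G
  · have h1 := card_mul_le_of_modEq (L := numMessages n (R 0)) (x := (m 0 : ℕ)) (T := _)
      (fun s : Messages n R => (s 0 : ℕ)) (fun s hs s' hs' hss => messages_ext (Fin.ext hss)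
        ((hmem s hs).2.2.1.trans (hmem s' hs').2.2.1.symm)
        ((eq_of_known h (hmem s hs).1).trans (eq_of_known h (hmem s' hs').1).symm))
      (m 0).isLt fun s hs => ⟨(s 0).isLt, by
        have h2 := (hmem s hs).2.2.2
        rw [pairIndex, pairIndex, if_pos h, one_mul, one_mul,
          eq_of_known h (hmem s hs).1] at h2
        exact Nat.ModEq.add_right_cancel' _ h2, fun h2 => (hmem s hs).2.1 (Fin.ext h2)⟩
    rw [if_pos h, add_zero]
    have h3 := numMessages_le (n := n) (hR 0)
    have h4 : (0 : ℝ) < 2 ^ ((n : ℝ) * R 0) := by positivity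
    have h5 := (Nat.cast_le (α := ℝ)).2 h1
    push_cast at h5
    linarith
  · have hlt : ∀ s : Messages n R, numMessages n (R 2) * (s 0 : ℕ) + (s 2 : ℕ) <
        numMessages n (R 0) * numMessages n (R 2) := by
      intro s
      have h1 := (s 0).isLt
      have h2 := (s 2).isLt
      calc _ < numMessages n (R 2) * (s 0 : ℕ) + numMessages n (R 2) := by omega
        _ = numMessages n (R 2) * ((s 0 : ℕ) + 1) := by ring
        _ ≤ numMessages n (R 2) * numMessages n (R 0) := Nat.mul_le_mul_left _ h1
        _ = _ := mul_comm _ _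
    have hinj : ∀ s s' : Messages n R, numMessages n (R 2) * (s 0 : ℕ) + (s 2 : ℕ) =
        numMessages n (R 2) * (s' 0 : ℕ) + (s' 2 : ℕ) → s 0 = s' 0 ∧ s 2 = s' 2 := by
      intro s s' hss
      have hp : 0 < numMessages n (R 2) := one_le_numMessages _ _
      have h1 := congrArg (· / numMessages n (R 2)) hss
      have h2 := congrArg (· % numMessages n (R 2)) hss
      simp only [Nat.mul_add_div hp, Nat.div_eq_of_lt (s 2).isLt, Nat.div_eq_of_lt (s' 2).isLt,
        Nat.mul_add_mod, Nat.mod_eq_of_lt (s 2).isLt, Nat.mod_eq_of_lt (s' 2).isLt, add_zero]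
        at h1 h2
      exact ⟨Fin.ext h1, Fin.ext h2⟩
    have h1 := card_mul_le_of_modEq (T := _)
      (fun s : Messages n R => numMessages n (R 2) * (s 0 : ℕ) + (s 2 : ℕ))
      (fun s hs s' hs' hss => messages_ext (hinj s s' hss).1
        ((hmem s hs).2.2.1.trans (hmem s' hs').2.2.1.symm) (hinj s s' hss).2)
      (hlt m) fun s hs => ⟨hlt s, by
        have h2 := (hmem s hs).2.2.2
        rwa [pairIndex, pairIndex, if_neg h] at h2, fun h2 => (hmem s hs).2.1 (hinj s m h2).1⟩
    rw [if_neg h]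
    have h3 := numMessages_mul_le (n := n) (hR 0) (hR 2)
    have h4 : (0 : ℝ) < 2 ^ ((n : ℝ) * (R 0 + R 2)) := by positivity
    have h5 := (Nat.cast_le (α := ℝ)).2 h1
    push_cast at h5
    linarith

lemma card_rivals_split_two_le (hG : IsGroup7Member G) (hR : ∀ i, 0 ≤ R i) (ρ : ℝ)
    (m : Messages n R) :
    (((rivals id G 2 m).filter fun s => splitCloud G ρ s = splitCloud G ρ m).card : ℝ) ≤
      8 * 2 ^ ((n : ℝ) * (R 2 - ρ)) := by
  have hmem : ∀ s ∈ (rivals id G 2 m).filter fun s => splitCloud G ρ s = splitCloud G ρ m,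
      s 0 = m 0 ∧ s 1 = m 1 ∧ s 2 ≠ m 2 ∧
        pairIndex G s ≡ pairIndex G m [MOD numMessages n ρ] := by
    intro s hs
    rw [Finset.mem_filter, mem_rivals, splitCloud_eq_iff] at hs
    obtain ⟨⟨m', h1, h2, rfl⟩, h3⟩ := hs
    exact ⟨eq_of_known hG.mem_two_zero h1, h3.1, h2, h3.2⟩
  refine le_two_rpow_sub_of_mul_numMessages_le ?_ (Nat.cast_nonneg _)
  have h1 := card_mul_le_of_modEq (L := numMessages n (R 2)) (x := (m 2 : ℕ)) (T := _)
    (fun s : Messages n R => (s 2 : ℕ)) (fun s hs s' hs' hss => messages_ext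
      ((hmem s hs).1.trans (hmem s' hs').1.symm)
      ((hmem s hs).2.1.trans (hmem s' hs').2.1.symm) (Fin.ext hss))
    (m 2).isLt fun s hs => ⟨(s 2).isLt, by
      have h2 := (hmem s hs).2.2.2
      rw [pairIndex, pairIndex, (hmem s hs).1] at h2
      exact Nat.ModEq.add_left_cancel' _ h2, fun h2 => (hmem s hs).2.2.1 (Fin.ext h2)⟩
  have h3 := numMessages_le (n := n) (hR 2)
  have h4 : (0 : ℝ) < 2 ^ ((n : ℝ) * R 2) := by positivity
  have h5 := (Nat.cast_le (α := ℝ)).2 h1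
  push_cast at h5
  linarith

lemma card_rivals_id_zero_le (hG : IsGroup7Member G) (hR : ∀ i, 0 ≤ R i) (m : Messages n R) :
    ((rivals id G 0 m).card : ℝ) ≤ 8 * 2 ^ ((n : ℝ) * (R 1 + sumRate13 G R)) := by
  have h01 := numMessages_mul_le (n := n) (hR 0) (hR 1)
  have h4 : (0 : ℝ) < 2 ^ ((n : ℝ) * (R 0 + R 1)) := by positivity
  rw [hG.sumRate13_eq]
  by_cases h : (0, 2) ∈ G
  · have h1 : (rivals id G 0 m).card ≤
        (Finset.univ : Finset (Fin (numMessages n (R 0)) × Fin (numMessages n (R 1)))).card := by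
      refine Finset.card_le_card_of_injOn (fun s => (s 0, s 1)) (fun _ _ => Finset.mem_coe.2
        (Finset.mem_univ _)) fun s hs s' hs' hss => ?_
      obtain ⟨_, h1, -, rfl⟩ := (mem_rivals _).1 hs
      obtain ⟨_, h1', -, rfl⟩ := (mem_rivals _).1 hs'
      simp only [Prod.mk.injEq] at hss
      exact messages_ext hss.1 hss.2 ((eq_of_known h h1).trans (eq_of_known h h1').symm)
    rw [Finset.card_univ, Fintype.card_prod, Fintype.card_fin, Fintype.card_fin] at h1
    rw [if_pos h, add_zero, add_comm (R 1)]
    have h5 := (Nat.cast_le (α := ℝ)).2 h1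
    push_cast at h5
    linarith
  · have h1 := (rivals id G 0 m).card_le_univ
    rw [Fintype.card_pi, Fin.prod_univ_three] at h1
    simp only [Fintype.card_fin] at h1
    have h5 := (Nat.cast_le (α := ℝ)).2 h1
    push_cast at h5
    rw [if_neg h, show R 1 + (R 0 + R 2) = R 0 + R 1 + R 2 by ring, mul_add,
      Real.rpow_add two_pos]
    calc _ ≤ _ := h5
      _ ≤ (4 * 2 ^ ((n : ℝ) * (R 0 + R 1))) * (2 * 2 ^ ((n : ℝ) * R 2)) := by
        gcongr; exact numMessages_le (hR 2)
      _ = _ := by ring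

lemma card_rivals_id_two_le (hG : IsGroup7Member G) (hR : ∀ i, 0 ≤ R i) (m : Messages n R) :
    ((rivals id G 2 m).card : ℝ) ≤ 8 * 2 ^ ((n : ℝ) * R 2) := by
  have h1 : (rivals id G 2 m).card ≤ (Finset.univ : Finset (Fin (numMessages n (R 2)))).card := by
    refine Finset.card_le_card_of_injOn (fun s => s 2) (fun _ _ => Finset.mem_coe.2
      (Finset.mem_univ _)) fun s hs s' hs' hss => ?_
    obtain ⟨_, h1, -, rfl⟩ := (mem_rivals _).1 hs
    obtain ⟨_, h1', -, rfl⟩ := (mem_rivals _).1 hs'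
    exact messages_ext
      ((eq_of_known hG.mem_two_zero h1).trans (eq_of_known hG.mem_two_zero h1').symm)
      ((eq_of_known hG.mem_two_one h1).trans (eq_of_known hG.mem_two_one h1').symm) hss
  rw [Finset.card_univ, Fintype.card_fin] at h1
  have h3 := numMessages_le (n := n) (hR 2)
  have h4 : (0 : ℝ) < 2 ^ ((n : ℝ) * R 2) := by positivity
  have h5 := (Nat.cast_le (α := ℝ)).2 h1
  linarith

/-- The sum of the two layers' bounds for receivers `1` and `0` is below the capacity of
receiver `0`, the stronger one. -/
lemma gaussC_layers_le (hN : ∀ i, 0 < N i) (hN01 : N 0 ≤ N 1) {pu pv : ℝ} (hpu : 0 ≤ pu)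
    (hpv : 0 ≤ pv) :
    gaussC (pu / (pv + N 1)) + gaussC (pv / N 0) ≤ gaussC ((pu + pv) / N 0) := by
  have h1 := hN 1
  have h0 := hN 0
  rw [← gaussC_add_gaussC hpu hpv h0]
  gcongr
  exact gaussC_mono (by positivity) (by gcongr)

theorem achievable_of_split_bounds (hG : IsGroup7Member G) (hR : ∀ i, 0 ≤ R i) (hP0 : 0 ≤ P)
    (hN : ∀ i, 0 < N i) (hN01 : N 0 ≤ N 1) {pu pv : ℝ} (hpu : 0 ≤ pu) (hpv : 0 ≤ pv)
    (hp : 0 < pu + pv) (hP : pu + pv < P)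
    (h1 : R 1 + sumRate13 G R < gaussC (pu / (pv + N 1)) + gaussC (pv / N 0))
    (h2 : R 1 < gaussC (pu / (pv + N 1)))
    (h3 : R 1 + R 2 < gaussC (pu / (pv + N 1)) + gaussC (pv / N 2))
    (h4 : R 2 < gaussC ((pu + pv) / N 2)) : Achievable G P N R := by
  -- `ρ` is the rate of the residue that the cloud centre carries next to message `1`
  obtain ⟨ρ, hρ1, hρ2⟩ : ∃ ρ, max 0 (max (sumRate13 G R - gaussC (pv / N 0))
      (R 2 - gaussC (pv / N 2))) < ρ ∧ ρ < gaussC (pu / (pv + N 1)) - R 1 :=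
    exists_between (max_lt (by linarith) (max_lt (by linarith) (by linarith)))
  rw [max_lt_iff, max_lt_iff] at hρ1
  obtain ⟨hρ0, hρa, hρb⟩ := hρ1
  refine achievable_of_superposition hP0 hN hpu hpv hp hP (e := fun n => id)
    (w := fun n => splitCloud G ρ) (K := 8) (ra := ![sumRate13 G R - ρ, 0, R 2 - ρ])
    (rb := ![R 1 + sumRate13 G R, R 1 + ρ, R 2]) ?_ ?_ ?_ ?_ ?_ ?_ ?_ ?_
  · exact fun n i _ m m' _ h => congrFun h i
  · exact fun n m m' _ h => (splitCloud_eq_iff.1 h).1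
  · intro n i hi m
    fin_cases i
    · exact card_rivals_split_zero_le hG hR ρ m
    · exact absurd rfl hi
    · exact card_rivals_split_two_le hG hR ρ m
  · intro n i hi m
    fin_cases i
    · exact card_rivals_id_zero_le hG hR m
    · exact absurd rfl hi
    · exact card_rivals_id_two_le hG hR m
  · intro n m
    have h := (rivals (splitCloud G ρ ∘ id) G 1 m).card_le_univ
    rw [Fintype.card_prod, Fintype.card_fin, ZMod.card] at h
    have h5 := (Nat.cast_le (α := ℝ)).2 h
    push_cast at h5
    have h6 := numMessages_mul_le (n := n) (hR 1) hρ0.le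
    have h7 : (0 : ℝ) < 2 ^ ((n : ℝ) * (R 1 + ρ)) := by positivity
    change _ ≤ 8 * (2 : ℝ) ^ ((n : ℝ) * (R 1 + ρ))
    linarith
  · intro i hi
    fin_cases i
    · change sumRate13 G R - ρ < gaussC (pv / N 0); linarith
    · exact absurd rfl hi
    · change R 2 - ρ < gaussC (pv / N 2); linarith
  · intro i hi
    fin_cases i
    · exact h1.trans_le (gaussC_layers_le hN hN01 hpu hpv)
    · exact absurd rfl hi
    · exact h4
  · change R 1 + ρ < _; linarith

/-! ### The members with the arc `(1, 2)` -/

/-- The index of the satellite: message `0`, together with the index of the cloud centre. The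
latter is the network-coded sum of messages `1` and `2` modulo the larger of the two message
numbers, so that it gives either of these messages to a receiver that knows the other. -/
noncomputable def xorIndex (m : Messages n R) : Fin (numMessages n (R 0)) ×
    ZMod (max (numMessages n (R 1)) (numMessages n (R 2))) :=
  (m 0, ((m 1 : ℕ) : ZMod _) + ((m 2 : ℕ) : ZMod _))

instance (n : ℕ) (r r' : ℝ) : NeZero (max (numMessages n r) (numMessages n r')) :=
  ⟨(lt_max_of_lt_left (one_le_numMessages n r)).ne'⟩

lemma fin_eq_of_natCast_eq {L M : ℕ} (h : L ≤ M) {a b : Fin L}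
    (hab : ((a : ℕ) : ZMod M) = ((b : ℕ) : ZMod M)) : a = b := by
  rw [ZMod.natCast_eq_natCast_iff] at hab
  exact Fin.ext (hab.eq_of_lt_of_lt (a.isLt.trans_le h) (b.isLt.trans_le h))

lemma card_rivals_xor_zero_le (hG : IsGroup7Member G) (hR : ∀ i, 0 ≤ R i) (m : Messages n R)
    {r : ℝ} (hr1 : R 0 + R 1 ≤ r) (hr2 : sumRate13 G R ≤ r) :
    ((rivals xorIndex G 0 m).card : ℝ) ≤ 8 * 2 ^ ((n : ℝ) * r) := by
  have h01 := (numMessages_mul_le (n := n) (hR 0) (hR 1)).trans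
    (mul_le_mul_of_nonneg_left (Real.rpow_le_rpow_of_exponent_le one_le_two
      (mul_le_mul_of_nonneg_left hr1 (Nat.cast_nonneg n))) (by norm_num))
  have hpos : (0 : ℝ) < 2 ^ ((n : ℝ) * r) := by positivity
  rw [hG.sumRate13_eq] at hr2
  by_cases h : (0, 2) ∈ G
  · have h1 : (rivals xorIndex G 0 m).card ≤
        (Finset.univ : Finset (Fin (numMessages n (R 0)) × Fin (numMessages n (R 1)))).card := by
      refine Finset.card_le_card_of_surjOn (fun q => (q.1, ((q.2 : ℕ) : ZMod _) +
        ((m 2 : ℕ) : ZMod _))) fun s hs => ?_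
      obtain ⟨m', h1, -, rfl⟩ := (mem_rivals _).1 hs
      refine ⟨(m' 0, m' 1), Finset.mem_coe.2 (Finset.mem_univ _), ?_⟩
      simp only [xorIndex, eq_of_known h h1]
    rw [Finset.card_univ, Fintype.card_prod, Fintype.card_fin, Fintype.card_fin] at h1
    have h5 := (Nat.cast_le (α := ℝ)).2 h1
    push_cast at h5
    linarith
  · rw [if_neg h] at hr2
    have h02 := (numMessages_mul_le (n := n) (hR 0) (hR 2)).trans
      (mul_le_mul_of_nonneg_left (Real.rpow_le_rpow_of_exponent_le one_le_two
        (mul_le_mul_of_nonneg_left hr2 (Nat.cast_nonneg n))) (by norm_num))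
    have h1 := (rivals (xorIndex (n := n) (R := R)) G 0 m).card_le_univ
    rw [Fintype.card_prod, Fintype.card_fin, ZMod.card] at h1
    have h5 := (Nat.cast_le (α := ℝ)).2 (h1.trans (Nat.mul_le_mul_left _
      (max_le_add_of_nonneg (Nat.zero_le _) (Nat.zero_le _))))
    push_cast at h5
    linarith

lemma card_rivals_xor_two_le (hG : IsGroup7Member G) (hR : ∀ i, 0 ≤ R i) (m : Messages n R) :
    ((rivals xorIndex G 2 m).card : ℝ) ≤ 8 * 2 ^ ((n : ℝ) * R 2) := by
  have h1 : (rivals xorIndex G 2 m).card ≤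
      (Finset.univ : Finset (Fin (numMessages n (R 2)))).card := by
    refine Finset.card_le_card_of_surjOn (fun q => (m 0, ((m 1 : ℕ) : ZMod _) +
      ((q : ℕ) : ZMod _))) fun s hs => ?_
    obtain ⟨m', h1, -, rfl⟩ := (mem_rivals _).1 hs
    refine ⟨m' 2, Finset.mem_coe.2 (Finset.mem_univ _), ?_⟩
    simp only [xorIndex, eq_of_known hG.mem_two_zero h1, eq_of_known hG.mem_two_one h1]
  rw [Finset.card_univ, Fintype.card_fin] at h1
  have h3 := numMessages_le (n := n) (hR 2)
  have h4 : (0 : ℝ) < 2 ^ ((n : ℝ) * R 2) := by positivity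
  have h5 := (Nat.cast_le (α := ℝ)).2 h1
  linarith

lemma card_rivals_xor_one_le (h : (1, 2) ∈ G) (hR : ∀ i, 0 ≤ R i) (m : Messages n R) :
    ((rivals (Prod.snd ∘ xorIndex) G 1 m).card : ℝ) ≤ 8 * 2 ^ ((n : ℝ) * R 1) := by
  have h1 : (rivals (Prod.snd ∘ xorIndex) G 1 m).card ≤
      (Finset.univ : Finset (Fin (numMessages n (R 1)))).card := by
    refine Finset.card_le_card_of_surjOn (fun q => ((q : ℕ) : ZMod _) +
      ((m 2 : ℕ) : ZMod _)) fun s hs => ?_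
    obtain ⟨m', h1, -, rfl⟩ := (mem_rivals _).1 hs
    refine ⟨m' 1, Finset.mem_coe.2 (Finset.mem_univ _), ?_⟩
    simp only [Function.comp_apply, xorIndex, eq_of_known h h1]
  rw [Finset.card_univ, Fintype.card_fin] at h1
  have h3 := numMessages_le (n := n) (hR 1)
  have h4 : (0 : ℝ) < 2 ^ ((n : ℝ) * R 1) := by positivity
  have h5 := (Nat.cast_le (α := ℝ)).2 h1
  linarith

/-- Receiver `2`, who knows message `1`, recovers message `2` from the index of the cloud centre. -/
lemma eq_of_xorIndex_eq (hG : IsGroup7Member G) {m m' : Messages n R}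
    (hm : known G 2 m' = known G 2 m) (h : (xorIndex m').2 = (xorIndex m).2) : m' 2 = m 2 := by
  simp only [xorIndex, eq_of_known hG.mem_two_one hm] at h
  exact fin_eq_of_natCast_eq (le_max_right _ _) (add_left_cancel h)

theorem achievable_of_xor_bounds (hG : IsGroup7Member G) (h12 : (1, 2) ∈ G) (hR : ∀ i, 0 ≤ R i)
    (hP0 : 0 ≤ P) (hN : ∀ i, 0 < N i) (hN01 : N 0 ≤ N 1) {pu pv : ℝ} (hpu : 0 ≤ pu)
    (hpv : 0 ≤ pv) (hp : 0 < pu + pv) (hP : pu + pv < P) (h1 : R 0 < gaussC (pv / N 0))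
    (h2 : sumRate13 G R < gaussC ((pu + pv) / N 0)) (h3 : R 1 < gaussC (pu / (pv + N 1)))
    (h4 : R 2 < gaussC ((pu + pv) / N 2)) : Achievable G P N R := by
  -- receiver `2` has no rivals with the right cloud centre, hence the rate `-1`
  refine achievable_of_superposition hP0 hN hpu hpv hp hP (e := fun n => xorIndex)
    (w := fun n => Prod.snd) (K := 8) (ra := ![R 0, 0, -1])
    (rb := ![max (R 0 + R 1) (sumRate13 G R), R 1, R 2]) ?_ ?_ ?_ ?_ ?_ ?_ ?_ ?_
  · intro n i hi m m' hm h
    fin_cases i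
    · exact congrArg Prod.fst h
    · exact absurd rfl hi
    · exact eq_of_xorIndex_eq hG hm (congrArg Prod.snd h)
  · intro n m m' hm h
    simp only [xorIndex, eq_of_known h12 hm] at h
    exact fin_eq_of_natCast_eq (le_max_left _ _) (add_right_cancel h)
  · intro n i hi m
    fin_cases i
    · have h := Finset.card_le_card_of_injOn (t := Finset.univ)
        (s := (rivals xorIndex G 0 m).filter fun s => s.2 = (xorIndex m).2) Prod.fst
        (fun _ _ => Finset.mem_coe.2 (Finset.mem_univ _)) fun s hs s' hs' hss =>
          Prod.ext hss (((Finset.mem_filter.1 hs).2).trans (Finset.mem_filter.1 hs').2.symm)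
      rw [Finset.card_univ, Fintype.card_fin] at h
      have h6 := numMessages_le (n := n) (hR 0)
      have h7 : (0 : ℝ) < 2 ^ ((n : ℝ) * R 0) := by positivity
      have h5 := (Nat.cast_le (α := ℝ)).2 h
      change _ ≤ 8 * (2 : ℝ) ^ ((n : ℝ) * R 0)
      refine h5.trans ?_
      linarith
    · exact absurd rfl hi
    · have h : (rivals xorIndex G 2 m).filter (fun s => s.2 = (xorIndex m).2) = ∅ := by
        refine Finset.filter_eq_empty_iff.2 fun s hs hsm => ?_
        obtain ⟨m', h1, h2, rfl⟩ := (mem_rivals _).1 hs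
        exact h2 (eq_of_xorIndex_eq hG h1 hsm)
      refine le_trans (le_of_eq ?_) (by positivity : (0 : ℝ) ≤ _)
      exact Nat.cast_eq_zero.2 (Finset.card_eq_zero.2 h)
  · intro n i hi m
    fin_cases i
    · exact card_rivals_xor_zero_le hG hR m (le_max_left _ _) (le_max_right _ _)
    · exact absurd rfl hi
    · exact card_rivals_xor_two_le hG hR m
  · exact fun n m => card_rivals_xor_one_le h12 hR m
  · intro i hi
    fin_cases i
    · exact h1
    · exact absurd rfl hi
    · have h2 := hN 2
      exact neg_one_lt_zero.trans_le (gaussC_nonneg (by positivity))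
  · intro i hi
    fin_cases i
    · refine max_lt ?_ h2
      have := gaussC_layers_le hN hN01 hpu hpv
      change R 0 + R 1 < gaussC ((pu + pv) / N 0)
      linarith
    · exact absurd rfl hi
    · exact h4
  · exact h3

/-! ### Strict bounds leave some power to spare -/

lemma eventually_splitBounds (hP : 0 < P) (hN : ∀ i, 0 < N i) {α : ℝ} (hα0 : 0 ≤ α) (hα1 : α ≤ 1)
    (h : SplitBounds G P N R α) : ∀ᶠ p in 𝓝 P, SplitBounds G p N R α := by
  have h1 := hN 1
  have hα : 0 ≤ 1 - α := by linarith
  have hc : ContinuousAt (fun p => gaussC ((1 - α) * p / (α * p + N 1))) P :=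
    continuousAt_gaussC_comp (ContinuousAt.div (by fun_prop) (by fun_prop) (by positivity))
      (by positivity)
  have hv : ∀ i, ContinuousAt (fun p => gaussC (α * p / N i)) P := fun i =>
    continuousAt_gaussC_comp (by fun_prop) (by have := hN i; positivity)
  have ht : ContinuousAt (fun p => gaussC (p / N 2)) P :=
    continuousAt_gaussC_comp (by fun_prop) (by have := hN 2; positivity)
  exact ((hc.add (hv 0)).eventually_const_lt h.1).and ((hc.eventually_const_lt h.2.1).and
    (((hc.add (hv 2)).eventually_const_lt h.2.2.1).and (ht.eventually_const_lt h.2.2.2)))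

lemma eventually_xorBounds (hP : 0 < P) (hN : ∀ i, 0 < N i) {α : ℝ} (hα0 : 0 ≤ α) (hα1 : α ≤ 1)
    (h : XorBounds G P N R α) : ∀ᶠ p in 𝓝 P, XorBounds G p N R α := by
  have h1 := hN 1
  have hα : 0 ≤ 1 - α := by linarith
  have hc : ContinuousAt (fun p => gaussC ((1 - α) * p / (α * p + N 1))) P :=
    continuousAt_gaussC_comp (ContinuousAt.div (by fun_prop) (by fun_prop) (by positivity))
      (by positivity)
  have hv : ContinuousAt (fun p => gaussC (α * p / N 0)) P :=
    continuousAt_gaussC_comp (by fun_prop) (by have := hN 0; positivity)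
  have ht : ∀ i, ContinuousAt (fun p => gaussC (p / N i)) P := fun i =>
    continuousAt_gaussC_comp (by fun_prop) (by have := hN i; positivity)
  exact (hv.eventually_const_lt h.1).and (((ht 0).eventually_const_lt h.2.1).and
    ((hc.eventually_const_lt h.2.2.1).and ((ht 2).eventually_const_lt h.2.2.2)))

lemma exists_pos_lt_of_eventually {p : ℝ → Prop} (hP : 0 < P) (h : ∀ᶠ x in 𝓝 P, p x) :
    ∃ x, 0 < x ∧ x < P ∧ p x := by
  have h1 : ∀ᶠ x in 𝓝[<] P, x ∈ Set.Ioo 0 P := Ioo_mem_nhdsLT hP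
  obtain ⟨x, hx, hx'⟩ := (h1.and (h.filter_mono nhdsWithin_le_nhds)).exists
  exact ⟨x, hx.1, hx.2, hx'⟩

end Members

end AWGNBroadcast

theorem theorem3 (G : AWGNBroadcast.SideInfoGraph) (hG : AWGNBroadcast.IsGroup7Member G)
    (P : ℝ) (hP : 0 ≤ P) (N : Fin 3 → ℝ) (hN : 0 < N 0) (hN12 : N 0 ≤ N 1) (hN23 : N 1 ≤ N 2)
    (R : Fin 3 → ℝ) (hR : R ∈ AWGNBroadcast.innerRegion7 G P N) :
    AWGNBroadcast.Achievable G P N R := by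
  open AWGNBroadcast in
  obtain ⟨hR0, α, hα0, hα1, hR⟩ := hR
  have hNpos : ∀ i, 0 < N i := by
    intro i; fin_cases i
    exacts [hN, hN.trans_le hN12, hN.trans_le (hN12.trans hN23)]
  have hα : 0 ≤ 1 - α := by linarith
  -- without power the bound on the rate of receiver `1` would be `R 1 < 0`
  have hP0 : 0 < P := by
    refine hP.lt_of_ne fun h0 => ?_
    have hlt : R 1 < gaussC ((1 - α) * P / (α * P + N 1)) := by
      rcases hR with ⟨-, h⟩ | ⟨-, h⟩
      exacts [h.2.1, h.2.2.1]
    rw [← h0] at hlt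
    simp only [mul_zero, zero_add, zero_div, gaussC, add_zero, Real.logb_one] at hlt
    exact absurd hlt (not_lt.2 (hR0 1))
  rcases hR with ⟨-, h⟩ | ⟨h12, h⟩
  · obtain ⟨p, hp0, hpP, h⟩ :=
      exists_pos_lt_of_eventually hP0 (eventually_splitBounds hP0 hNpos hα0 hα1 h)
    have e : (1 - α) * p + α * p = p := by ring
    exact achievable_of_split_bounds hG hR0 hP hNpos hN12 (pu := (1 - α) * p) (pv := α * p)
      (by positivity) (by positivity) (by rwa [e]) (by rwa [e]) h.1 h.2.1 h.2.2.1
      (by rw [e]; exact h.2.2.2)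
  · obtain ⟨p, hp0, hpP, h⟩ :=
      exists_pos_lt_of_eventually hP0 (eventually_xorBounds hP0 hNpos hα0 hα1 h)
    have e : (1 - α) * p + α * p = p := by ring
    exact achievable_of_xor_bounds hG h12 hR0 hP hNpos hN12 (pu := (1 - α) * p) (pv := α * p)
      (by positivity) (by positivity) (by rwa [e]) (by rwa [e]) h.1
      (by rw [e]; exact h.2.1) h.2.2.1 (by rw [e]; exact h.2.2.2)
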